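/- \textbf{Setting.} Let $n\ge 1$, let $\zeta\neq 0$, $\phi$, $\beta_i$, $\varepsilon_i$ ($1\le i\le n$) be real constants, let ${\bf X}_0$ be a constant real symmetric $n\times n$ matrix with diagonal entries $\gamma_i$ and off-diagonal entries $\alpha_{ij}$, and put ${\bf X}=-2Z{\bf 1}_n+{\bf X}_0$ and \[ {\bf N}=\begin{pmatrix} Y & \beta^T & Z\\ \beta & {\bf X} & \varepsilon\\ Z & \varepsilon^T & \phi\end{pmatrix},\qquad Q(Z)=\det\begin{pmatrix}{\bf X}&\varepsilon\\ \varepsilon^T&\phi\end{pmatrix},\qquad L(Z)=\det{\bf N}\big|_{Y=0}, \] so that $\det{\bf N}=Y\,Q(Z)+L(Z)$. Eliminating $Y$ from the quadric ansatz system $\det {\bf N}=4\zeta (Z')^2$, $Y'+2u^mZ'=0$ (where $'=d/du$) gives the reduced ODE \[ Z''=A(Z)\,(Z')^2+B(Z)+C(Z)\,u^m,\qquad A=\frac{Q'}{2Q},\quad B=\frac{1}{8\zeta}\Big(L'-L\frac{Q'}{Q}\Big),\quad C=-\frac{Q}{4\zeta}, \tag{1} \] where $Q'$ and $L'$ denote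 derivatives with respect to $Z$. Equation (1) is considered for holomorphic functions $Z(u)$ of a complex variable $u$ with $Q(Z(u))\ne 0$. It has no fixed singularities in the finite $u$-plane, and it is said to have the \emph{Painlev\'e property} if its solutions have no singularities other than poles, i.e. if every local holomorphic solution extends to a single-valued meromorphic function on $\mathbb{C}$. \textbf{Proposition.} Let $m=1$, $\phi=0$, and let at least one $\varepsilon_i$ be non-zero. \begin{enumerate} \item If $n=1$, then (1) is equivalent to the first Painlev\'e equation $w''=6w^2+x$ under a substitution $w(x)=a\,Z(lx+v)+b$ with complex constants $a\ne0$, $l\neq0$, $b$, $v$. If moreover $\beta=0$ and ${\bf X}_0=0$, then one can take $b=v=0$, i.e. constant rescalings suffice. \item If $n>1$, then (1) does not have the Painlev\'e property. \item If $n>2$, then (1) has movable algebraic branch points with exponent $-\frac2n$: for every $u_0\in\mathbb{C}$ there is a family of solutions $Z_c$, $c\in\mathbb{C}$, each of the form $Z_c(u)=W_c\big((u-u_0)^{1/n}\big)$ with $W_c$ holomorphic on a punctured disc around $0$, such that $Z_c(u)\sim a\,(u-u_0)^{-2/n}$ as $u\to u_0$ for some $a=a(c)\ne0$; different values of $c$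 give different multi-valued functions. \item If $n=2$, then (1) has movable logarithmic branch points: put $\alpha=\alpha_{12}$; for each $\kappa$ with $\kappa^2=-\zeta$ and all $u_0,c\in\mathbb{C}$ there is a multi-valued solution, holomorphic as a function of $s=\ln(u-u_0)$ on a region $\{\mathrm{Re}\,s+|\mathrm{Im}\,s|<M\}$, with \begin{align*} Z(u)={}&\frac{\kappa}{u-u_0}+\frac{\gamma_1+\gamma_2}{8}\\ &-\frac{32\big(u_0(\varepsilon_1^2+\varepsilon_2^2)+\beta_1\varepsilon_1+\beta_2\varepsilon_2\big)-8\alpha^2-3(\gamma_1^2+\gamma_2^2)+2\gamma_1\gamma_2}{192\kappa}\,(u-u_0)\\ &+\Big(c+\frac{\varepsilon_1^2+\varepsilon_2^2}{8\kappa}\ln(u-u_0)\Big)(u-u_0)^2+o\big((u-u_0)^2\big) \end{align*} as $\mathrm{Re}\,s\to-\infty$ within this region. \end{enumerate} -/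

import Mathlib

open Filter Topology Asymptotics

/-! ### Second order equations `Z'' = A(Z) (Z')² + B(Z) + C(Z) uᵐ` in the complex domain -/

/-- The equation `Z'' = A(Z) (Z')² + B(Z) + C(Z) uᵐ`; `reg` is the set of values of `Z` at which
the coefficients are defined. As the right-hand side is polynomial in `u`, such an equation has
no fixed singularities in the finite `u`-plane: all its singularities are movable. -/
structure ScalarODE where
  A : ℂ → ℂ
  B : ℂ → ℂ
  C : ℂ → ℂ
  m : ℕ
  reg : Set ℂ

namespace ScalarODE

/-- `Z` is a holomorphic (single-valued) solution on the open set `U`. -/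
def IsSolutionOn (E : ScalarODE) (U : Set ℂ) (Z : ℂ → ℂ) : Prop :=
  DifferentiableOn ℂ Z U ∧ ∀ u ∈ U, Z u ∈ E.reg ∧
    deriv (deriv Z) u = E.A (Z u) * deriv Z u ^ 2 + E.B (Z u) + E.C (Z u) * u ^ E.m

/-- `W` is a solution on the open set `Ω`, written in a parameter `s` with `u = p s`, where `p`
is holomorphic with non-vanishing derivative; `d/du` is `(1 / p'(s)) d/ds`. Equivalently,
`W ∘ q` is a solution for every local holomorphic inverse `q` of `p`. When `p` is a covering of a
punctured neighbourhood of `u₀`, `W` describes a multi-valued solution `Z(u)` around `u₀`. -/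
def IsSolutionAlong (E : ScalarODE) (p : ℂ → ℂ) (Ω : Set ℂ) (W : ℂ → ℂ) : Prop :=
  DifferentiableOn ℂ p Ω ∧ DifferentiableOn ℂ W Ω ∧ ∀ s ∈ Ω, deriv p s ≠ 0 ∧ W s ∈ E.reg ∧
    deriv (fun x => deriv W x / deriv p x) s / deriv p s =
      E.A (W s) * (deriv W s / deriv p s) ^ 2 + E.B (W s) + E.C (W s) * p s ^ E.m

/-- The Painlevé property: the only singularities of solutions are poles, i.e. every local
holomorphic solution continues to a single-valued meromorphic function on the plane (there are no
fixed singularities for the equations considered here). -/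
def HasPainleveProperty (E : ScalarODE) : Prop :=
  ∀ (u₀ : ℂ) (r : ℝ) (Z : ℂ → ℂ), 0 < r → E.IsSolutionOn (Metric.ball u₀ r) Z →
    ∃ f : ℂ → ℂ, Meromorphic f ∧ Set.EqOn f Z (Metric.ball u₀ r)

/-- `Z(u) = W((u - u₀)^(1/N))` is a solution with an algebraic branch point at `u₀` of exponent
`k / N ∉ ℤ`: the function `W` of `t = (u - u₀)^(1/N)` is holomorphic and solves the equation on a
punctured disc, and `Z ~ a (u - u₀)^(k/N)` with `a ≠ 0`. -/
def IsAlgebraicBranch (E : ScalarODE) (u₀ : ℂ) (k : ℤ) (N : ℕ) (W : ℂ → ℂ) : Prop :=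
  0 < N ∧ ¬ (N : ℤ) ∣ k ∧
    (∃ δ : ℝ, 0 < δ ∧
      E.IsSolutionAlong (fun t => u₀ + t ^ N) (Metric.ball 0 δ \ {0}) W) ∧
    ∃ a : ℂ, a ≠ 0 ∧ Tendsto (fun t => W t / t ^ k) (𝓝[≠] 0) (𝓝 a)

/-- The region `Re s + |Im s| < M` in the plane of `s = log (u - u₀)`. It contains, on each sheet of
the logarithm, a neighbourhood of `u₀` (the size of which depends on the sheet). -/
def logRegion (M : ℝ) : Set ℂ := {s | s.re + |s.im| < M}

/-- Affine equivalence of two equations: with constants `a ≠ 0`, `b`, `l ≠ 0`, `v`, the substitution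
`w(x) = a Z(l x + v) + b` turns the solutions of `E` into the solutions of `E'`, and conversely. -/
def AffineEquiv (E E' : ScalarODE) (a b l v : ℂ) : Prop :=
  a ≠ 0 ∧ l ≠ 0 ∧ ∀ (U : Set ℂ) (Z : ℂ → ℂ), IsOpen U →
    (E.IsSolutionOn U Z ↔
      E'.IsSolutionOn ((fun x => l * x + v) ⁻¹' U) (fun x => a * Z (l * x + v) + b))

/-- The first Painlevé equation `w'' = 6 w² + x`. -/
def painleveI : ScalarODE where
  A := fun _ => 0
  B := fun w => 6 * w ^ 2
  C := fun _ => 1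
  m := 1
  reg := Set.univ

end ScalarODE

/-! ### The quadric ansatz reduction of the `mn`-dKP equation -/

/-- The constants of the reduction: the constant entries `φ`, `βᵢ`, `εᵢ` of `N`, the constant
symmetric matrix `X₀` (diagonal entries `γᵢ`, off-diagonal entries `αᵢⱼ`), and `ζ ≠ 0`. -/
structure QuadricConstants (n : ℕ) where
  φ : ℝ
  β : Fin n → ℝ
  ε : Fin n → ℝ
  X₀ : Matrix (Fin n) (Fin n) ℝ
  symm : X₀.IsSymm
  ζ : ℝ
  ζ_ne : ζ ≠ 0

namespace QuadricConstants

variable {n : ℕ} (d : QuadricConstants n)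

/-- `X = -2 Z 1ₙ + X₀`. -/
noncomputable def X (z : ℂ) : Matrix (Fin n) (Fin n) ℂ :=
  (-2 * z) • (1 : Matrix (Fin n) (Fin n) ℂ) + d.X₀.map (fun x : ℝ => (x : ℂ))

/-- The block `[X, ε; εᵀ, φ]` of `N`. -/
noncomputable def border (z : ℂ) : Matrix (Fin n ⊕ Unit) (Fin n ⊕ Unit) ℂ :=
  Matrix.fromBlocks (d.X z) (Matrix.of fun i _ => (d.ε i : ℂ))
    (Matrix.of fun _ j => (d.ε j : ℂ)) (Matrix.of fun _ _ => (d.φ : ℂ))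

/-- The matrix `N = [Y, βᵀ, Z; β, X, ε; Z, εᵀ, φ]`. -/
noncomputable def N (y z : ℂ) : Matrix (Unit ⊕ (Fin n ⊕ Unit)) (Unit ⊕ (Fin n ⊕ Unit)) ℂ :=
  Matrix.fromBlocks (Matrix.of fun _ _ => y)
    (Matrix.of fun _ j => Sum.elim (fun i => (d.β i : ℂ)) (fun _ => z) j)
    (Matrix.of fun i _ => Sum.elim (fun i => (d.β i : ℂ)) (fun _ => z) i)
    (d.border z)

/-- The coefficient of `Y` in `det N`. -/
noncomputable def Q (z : ℂ) : ℂ := (d.border z).det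

/-- The part of `det N` that does not contain `Y`. -/
noncomputable def L (z : ℂ) : ℂ := (d.N 0 z).det

theorem det_N (y z : ℂ) : (d.N y z).det = y * d.Q z + d.L z := by
  have h : d.N y z = (d.N 0 z).updateRow (Sum.inl ())
      (d.N 0 z (Sum.inl ()) + y • Sum.elim (fun _ => (1 : ℂ)) (fun _ => 0)) := by
    ext i j
    rcases i with i | i
    · rcases j with j | j <;> simp [N]
    · rw [Matrix.updateRow_ne (by simp)]
      rcases j with j | j <;> simp [N]
  have h2 : (d.N 0 z).updateRow (Sum.inl ()) (Sum.elim (fun _ => (1 : ℂ)) (fun _ => 0)) =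
      Matrix.fromBlocks 1 0
        (Matrix.of fun i _ => Sum.elim (fun i => (d.β i : ℂ)) (fun _ => z) i) (d.border z) := by
    ext i j
    rcases i with i | i
    · rcases j with j | j <;> simp
    · rcases j with j | j <;> simp [N, Matrix.updateRow_apply]
  rw [h, Matrix.det_updateRow_add, Matrix.det_updateRow_smul, h2, Matrix.det_fromBlocks_zero₁₂,
    Matrix.updateRow_eq_self]
  simp [Q, L, add_comm]

/-- The reduced equation, obtained by eliminating `Y` from `det N = 4 ζ (Z')²` and
`Y' + 2 uᵐ Z' = 0`. If `φ = 0` and `β = 0`, then `L(Z) = -Z² det X`. -/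
noncomputable def reducedODE (m : ℕ) : ScalarODE where
  A := fun z => 1 / 2 * logDeriv d.Q z
  B := fun z => 1 / (8 * d.ζ) * (deriv d.L z - d.L z * logDeriv d.Q z)
  C := fun z => -d.Q z / (4 * d.ζ)
  m := m
  reg := {z | d.Q z ≠ 0}

theorem differentiable_Q : Differentiable ℂ d.Q := by
  have h : ∀ i j, Differentiable ℂ fun z => d.border z i j := by
    rintro (i | i) (j | j) <;> (simp [border, X]; try fun_prop)
  unfold Q
  simp only [Matrix.det_apply]
  fun_prop

theorem differentiable_L : Differentiable ℂ d.L := by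
  have h : ∀ i j, Differentiable ℂ fun z => d.N 0 z i j := by
    rintro (i | i | i) (j | j | j) <;> (simp [N, border, X]; try fun_prop)
  unfold L
  simp only [Matrix.det_apply]
  fun_prop

/-- The reduced equation does arise from the system `Y' + 2 uᵐ Z' = 0`, `det N = 4 ζ (Z')²`. -/
theorem isSolutionOn_of_system (m : ℕ) {U : Set ℂ} (hU : IsOpen U) {Y Z : ℂ → ℂ}
    (hY : DifferentiableOn ℂ Y U) (hZ : DifferentiableOn ℂ Z U)
    (hZ' : ∀ u ∈ U, deriv Z u ≠ 0) (hQ : ∀ u ∈ U, d.Q (Z u) ≠ 0)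
    (h1 : ∀ u ∈ U, deriv Y u + 2 * u ^ m * deriv Z u = 0)
    (h2 : ∀ u ∈ U, (d.N (Y u) (Z u)).det = 4 * d.ζ * deriv Z u ^ 2) :
    (d.reducedODE m).IsSolutionOn U Z := by
  refine ⟨hZ, fun u hu => ⟨hQ u hu, ?_⟩⟩
  have hζ : (d.ζ : ℂ) ≠ 0 := by exact_mod_cast d.ζ_ne
  have nU := hU.mem_nhds hu
  have dY := (hY.differentiableAt nU).hasDerivAt
  have dZ := (hZ.differentiableAt nU).hasDerivAt
  have dZ' := ((hZ.deriv hU).differentiableAt nU).hasDerivAt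
  have dQ := (d.differentiable_Q (Z u)).hasDerivAt.comp u dZ
  have dL := (d.differentiable_L (Z u)).hasDerivAt.comp u dZ
  have e : (fun x => Y x * d.Q (Z x) + d.L (Z x)) =ᶠ[𝓝 u]
      fun x => 4 * (d.ζ : ℂ) * deriv Z x ^ 2 := by
    filter_upwards [nU] with x hx
    rw [← d.det_N, h2 x hx]
  have k1 := ((dY.mul dQ).add dL).unique
    (((dZ'.pow 2).const_mul (4 * (d.ζ : ℂ))).congr_of_eventuallyEq e)
  have k2 := h1 u hu
  have k3 := e.self_of_nhds
  have q := hQ u hu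
  have z' := hZ' u hu
  simp only [reducedODE, logDeriv_apply]
  simp only [Function.comp] at k1 k3
  norm_num at k1
  have k4 : deriv Y u = -(2 * u ^ m * deriv Z u) := by linear_combination k2
  rw [k4] at k1
  field_simp
  apply mul_left_cancel₀ z'
  linear_combination (-8 * d.Q (Z u)) * k1 + 8 * deriv d.Q (Z u) * deriv Z u * k3

end QuadricConstants

/-!
The equation comes from the system `Y' + 2 u Z' = 0`, `det N = 4 ζ (Z')²`. With `H = Y + 2 u Z` the
system reads `H' = 2 Z`, `4 ζ (Z')² = (H - 2 u Z) Q(Z) + L(Z)`. For `φ = 0` the right-hand side of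
the second equation is `-(-2) ^ n Z ^ (n + 2)` times a polynomial in `1 / Z` with constant term `1`,
the `radicand` (`QuadricConstants.mul_Q_add_L_eq`), so that a solution that tends to infinity at `u₀`
behaves like `a (u - u₀) ^ (-2 / n)` with `a ^ n = -16 ζ / (n² (-2) ^ n)`.

For `n ≥ 2` such solutions are constructed in the parameter `s` with `u = u₀ + e^{ns}`. Let `E` be the
power `-n / 2` of the ratio of `Z` to its leading term `a e^{-2s}`. The system becomes
`E' = n (S - E)`, `H' = 2 n e^{ns} Z`, where `S`, close to `1`, is the square root of the radicand
(`QuadricConstants.IsBranchSystem`). It is singular only at `Re s = -∞`: with `E = 1 + e^s ξ`, the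
unknowns `(ξ, G)`, where `G` is `H` without its term linear in `s`, solve an integral equation over the
half-lines `s + (-∞, 0]` whose integrand is `O(e^{Re s})`, and the Picard iteration converges on every
left-invariant open set that lies far enough to the left, where for `n = 2` the imaginary part may grow
at most like `e^{-Re s}` because of the linear term of `H` (`exists_singularODE_solution`,
`QuadricConstants.exists_isBranchSystem`). The limit of `G` is a free parameter. Only for `n = 2` is
the forcing of `H` not small; then `H = 4 a s + G`, and this term is the source of the logarithm.

* For `n > 2` the functions have period `2πi` in `s`, hence are single-valued in
  `t = e^s = (u - u₀) ^ (1 / n)`. The limit of `H` at the branch point is a function of the solution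
  and does not depend on the parametrization, so that different values of the free parameter give
  different multi-valued solutions (`QuadricConstants.exists_algebraic_branch_family`).
* If local solutions extended meromorphically, then the identity theorem would give
  `Z(s + 2πi / n) = Z(s)` on a region that contains several sheets
  (`ScalarODE.HasPainleveProperty.eventually_periodic`). For `n > 2` the leading term changes by the
  factor `e^{-4πi / n} ≠ 1`; for `n = 2` the function `H`, which is determined by `Z`, changes by
  `4 a πi ≠ 0` (`QuadricConstants.not_hasPainleveProperty`).
* For `n = 2`, after replacing `s` by `s / 2`, let `ρ` be the difference between `E` and its formal
  expansion up to the terms `τ³` and `τ³ ln τ`, `τ = e^s`. Then `ρ' = h - ρ` with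
  `h = τ ρ O(1) + o(τ³)`; each use of this equation gains a factor `τ`, until `ρ = o(τ³)`
  (`ScalarODE.isLittleO_sub_truncE`). The coefficient of `τ³` in `E` is an affine function of the
  constant term of `H`, with slope a non-zero multiple of `∑ εᵢ²`, and so takes any prescribed value
  (`QuadricConstants.exists_logarithmic_branch`).
* For `n = 1` the function `Q` is a non-zero constant and `L` is a cubic polynomial, so that an affine
  substitution leads to Painlevé I (`QuadricConstants.affineEquiv_painleveI`).
-/

/-! ### Integration along leftward half-lines -/

section HalfLine

open MeasureTheory Set

/-- A set of complex numbers stable under translation to the left. -/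
def LeftInvariant (Ω : Set ℂ) : Prop := ∀ s ∈ Ω, ∀ r : ℝ, r ≤ 0 → s + r ∈ Ω

/-- The solution `∫_{-∞}^0 e^{kr} h(s + r) dr` of `y' = h - k y` that decays as `Re s → -∞`. -/
noncomputable def halfLineIntegral (k : ℝ) (h : ℂ → ℂ) (s : ℂ) : ℂ :=
  ∫ r in Iic (0 : ℝ), Complex.exp (k * r) * h (s + r)

variable {Ω : Set ℂ} {h : ℂ → ℂ} {C k : ℝ}

theorem norm_exp_mul_le (hk : 0 ≤ k) {r : ℝ} (hr : r ≤ 0) : ‖Complex.exp (k * r)‖ ≤ 1 := by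
  rw [Complex.norm_exp, Real.exp_le_one_iff]
  simpa using mul_nonpos_of_nonneg_of_nonpos hk hr

theorem norm_halfLineIntegrand_le (hl : LeftInvariant Ω) (hk : 0 ≤ k)
    (hb : ∀ s ∈ Ω, ‖h s‖ ≤ C * Real.exp s.re) {s : ℂ} (hs : s ∈ Ω) {r : ℝ} (hr : r ≤ 0) :
    ‖Complex.exp (k * r) * h (s + r)‖ ≤ C * Real.exp s.re * Real.exp r := by
  rw [norm_mul]
  have h1 := hb _ (hl s hs r hr)
  have h2 := norm_exp_mul_le hk hr
  calc _ ≤ 1 * ‖h (s + r)‖ := by gcongr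
    _ ≤ _ := by
      rw [one_mul]
      simpa [Real.exp_add, mul_assoc] using h1

theorem continuousOn_comp_halfLine (hl : LeftInvariant Ω) (hh : ContinuousOn h Ω)
    {s : ℂ} (hs : s ∈ Ω) :
    ContinuousOn (fun r : ℝ => Complex.exp (k * r) * h (s + r)) (Iic 0) := by
  refine ContinuousOn.mul (by fun_prop) (hh.comp (by fun_prop) fun r hr => hl s hs r hr)

theorem integrableOn_halfLine (hl : LeftInvariant Ω) (hk : 0 ≤ k) (hh : ContinuousOn h Ω)
    (hb : ∀ s ∈ Ω, ‖h s‖ ≤ C * Real.exp s.re) {s : ℂ} (hs : s ∈ Ω) :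
    IntegrableOn (fun r : ℝ => Complex.exp (k * r) * h (s + r)) (Iic 0) := by
  have h0 : IntegrableOn (fun r : ℝ => C * Real.exp s.re * Real.exp r) (Iic 0) :=
    (integrableOn_exp_Iic 0).const_mul _
  refine Integrable.mono' h0
    ((continuousOn_comp_halfLine hl hh hs).aestronglyMeasurable measurableSet_Iic) ?_
  filter_upwards [ae_restrict_mem measurableSet_Iic] with r hr
  exact norm_halfLineIntegrand_le hl hk hb hs hr

theorem norm_halfLineIntegral_le (hl : LeftInvariant Ω) (hk : 0 ≤ k)
    (hb : ∀ s ∈ Ω, ‖h s‖ ≤ C * Real.exp s.re) {s : ℂ} (hs : s ∈ Ω) :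
    ‖halfLineIntegral k h s‖ ≤ C * Real.exp s.re := by
  have h0 : IntegrableOn (fun r : ℝ => C * Real.exp s.re * Real.exp r) (Iic 0) :=
    (integrableOn_exp_Iic 0).const_mul _
  have := norm_integral_le_of_norm_le h0
    (f := fun r : ℝ => Complex.exp (k * r) * h (s + r)) (by
      filter_upwards [ae_restrict_mem measurableSet_Iic] with r hr
      exact norm_halfLineIntegrand_le hl hk hb hs hr)
  rwa [integral_const_mul, integral_exp_Iic_zero, mul_one] at this

theorem hasDerivAt_halfLineIntegral (hΩ : IsOpen Ω) (hl : LeftInvariant Ω) (hk : 0 ≤ k)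
    (hh : DifferentiableOn ℂ h Ω) (hb : ∀ s ∈ Ω, ‖h s‖ ≤ C * Real.exp s.re) {s : ℂ}
    (hs : s ∈ Ω) :
    HasDerivAt (halfLineIntegral k h) (h s - k * halfLineIntegral k h s) s := by
  obtain ⟨ρ', hρ', hball⟩ := Metric.isOpen_iff.1 hΩ s hs
  obtain ⟨ρ, hρ, rfl⟩ : ∃ ρ : ℝ, 0 < ρ ∧ ρ' = 2 * ρ := ⟨ρ' / 2, by positivity, by ring⟩
  have hC : 0 ≤ C := by
    have := (norm_nonneg _).trans (hb s hs)
    exact nonneg_of_mul_nonneg_left this (Real.exp_pos _)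
  have hd : ∀ z ∈ Ω, HasDerivAt h (deriv h z) z := fun z hz =>
    (hh.differentiableAt (hΩ.mem_nhds hz)).hasDerivAt
  have hsub : Metric.ball s ρ ⊆ Ω := (Metric.ball_subset_ball (by linarith)).trans hball
  -- Cauchy's estimate on discs of radius `ρ` dominates the differentiated integrand
  have hcauchy : ∀ z ∈ Metric.ball s ρ, ∀ r : ℝ, r ≤ 0 →
      ‖deriv h (z + r)‖ ≤ C * Real.exp (s.re + 2 * ρ) * Real.exp r / ρ := by
    intro z hz r hr
    rw [Metric.mem_ball, dist_eq_norm] at hz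
    have hmem : ∀ y, ‖y - (z + r)‖ ≤ ρ → y ∈ Ω ∧ y.re ≤ s.re + 2 * ρ + r := by
      intro y hy
      have hy1 : ‖y - r - s‖ < 2 * ρ := by
        calc ‖y - r - s‖ = ‖(y - (z + r)) + (z - s)‖ := by congr 1; ring
          _ ≤ ‖y - (z + r)‖ + ‖z - s‖ := norm_add_le _ _
          _ < 2 * ρ := by linarith
      constructor
      · have := hl (y - r) (hball (by rwa [Metric.mem_ball, dist_eq_norm])) r hr
        simpa using this
      · have := (Complex.re_le_norm _).trans hy1.le
        simp at this
        linarith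
    refine Complex.norm_deriv_le_of_forall_mem_sphere_norm_le hρ ?_ ?_
    · refine DifferentiableOn.diffContOnCl_ball (U := Ω) hh fun y hy => (hmem y ?_).1
      rwa [Metric.mem_closedBall, dist_eq_norm] at hy
    · intro y hy
      rw [mem_sphere_iff_norm] at hy
      obtain ⟨h1, h2⟩ := hmem y hy.le
      refine (hb y h1).trans ?_
      rw [mul_assoc, ← Real.exp_add]
      gcongr
  have hdc : ContinuousOn (deriv h) Ω := (hh.deriv hΩ).continuousOn
  have hint := integrableOn_halfLine hl hk hh.continuousOn hb hs
  have hbound : IntegrableOn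
      (fun r : ℝ => C * Real.exp (s.re + 2 * ρ) * Real.exp r / ρ) (Iic 0) :=
    ((integrableOn_exp_Iic 0).const_mul _).div_const _
  have key := hasDerivAt_integral_of_dominated_loc_of_deriv_le (𝕜 := ℂ)
    (μ := volume.restrict (Iic (0 : ℝ)))
    (F := fun z (r : ℝ) => Complex.exp (k * r) * h (z + r))
    (F' := fun z (r : ℝ) => Complex.exp (k * r) * deriv h (z + r)) (x₀ := s)
    (s := Metric.ball s ρ)
    (bound := fun r : ℝ => C * Real.exp (s.re + 2 * ρ) * Real.exp r / ρ)
    (Metric.ball_mem_nhds s hρ) ?_ hint ?_ ?_ hbound ?_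
  · have hsum := integral_Iic_of_hasDerivAt_of_tendsto' (a := 0) (m := 0)
      (f := fun r : ℝ => Complex.exp (k * r) * h (s + r))
      (f' := fun r : ℝ => k * (Complex.exp (k * r) * h (s + r)) +
        Complex.exp (k * r) * deriv h (s + r)) ?_ ?_ ?_
    · rw [integral_add (hint.const_mul _) key.1, integral_const_mul] at hsum
      have e : h s - k * halfLineIntegral k h s =
          ∫ r in Iic (0 : ℝ), Complex.exp (k * r) * deriv h (s + r) := by
        rw [halfLineIntegral]
        simp only [Complex.ofReal_zero, mul_zero, Complex.exp_zero, add_zero, one_mul,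
          sub_zero] at hsum
        linear_combination -hsum
      rw [e]
      exact key.2
    · intro r hr
      have h1 : HasDerivAt (fun r : ℝ => Complex.exp (k * r))
          (Complex.exp (k * r) * k) r := by
        have := ((Complex.ofRealCLM.hasDerivAt (x := r)).const_mul (k : ℂ)).cexp
        simpa using this
      have h2 : HasDerivAt (fun r : ℝ => h (s + r)) (deriv h (s + r)) r := by
        have h3 : HasDerivAt (fun r : ℝ => s + (r : ℂ)) 1 r := by
          simpa using (Complex.ofRealCLM.hasDerivAt (x := r)).const_add s
        have h4 := (hd _ (hl s hs r hr)).comp r h3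
        rw [mul_one] at h4
        exact h4
      exact (h1.mul h2).congr_deriv (by ring)
    · exact (hint.const_mul _).add key.1
    · refine squeeze_zero_norm' (a := fun r : ℝ => C * Real.exp s.re * Real.exp r) ?_ ?_
      · filter_upwards [eventually_le_atBot 0] with r hr
        exact norm_halfLineIntegrand_le hl hk hb hs hr
      · simpa using Real.tendsto_exp_atBot.const_mul (C * Real.exp s.re)
  · filter_upwards [Metric.ball_mem_nhds s hρ] with z hz
    exact (continuousOn_comp_halfLine hl hh.continuousOn (hsub hz)).aestronglyMeasurable
      measurableSet_Iic
  · exact (continuousOn_comp_halfLine hl hdc hs).aestronglyMeasurable measurableSet_Iic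
  · filter_upwards [ae_restrict_mem measurableSet_Iic] with r hr z hz
    rw [norm_mul]
    calc _ ≤ 1 * ‖deriv h (z + r)‖ := by
          gcongr
          exact norm_exp_mul_le hk hr
      _ ≤ _ := by
          rw [one_mul]
          exact hcauchy z hz r hr
  · filter_upwards [ae_restrict_mem measurableSet_Iic] with r hr z hz
    have h3 : HasDerivAt (fun z : ℂ => z + (r : ℂ)) 1 z := (hasDerivAt_id z).add_const _
    simpa using ((hd _ (hl z (hsub hz) r hr)).comp z h3).const_mul (Complex.exp (k * r))

end HalfLine

/-! ### A singular initial value problem at `Re s = -∞` -/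

section SingularODE

open Metric Set

variable {Ω : Set ℂ} {C k : ℝ} {c : ℂ} {g : ℂ → ℂ × ℂ → ℂ × ℂ}

/-- The integral operator whose fixed points solve `y₁' = g₁(s, y) - k y₁`, `y₂' = g₂(s, y)` with
`y → (0, c)` as `Re s → -∞`. -/
noncomputable def singularPicard (k : ℝ) (c : ℂ) (g : ℂ → ℂ × ℂ → ℂ × ℂ) (f : ℂ → ℂ × ℂ)
    (s : ℂ) : ℂ × ℂ :=
  (halfLineIntegral k (fun z => (g z (f z)).1) s,
    c + halfLineIntegral 0 (fun z => (g z (f z)).2) s)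

/-- A bounded holomorphic map is Lipschitz well inside its domain. -/
theorem dist_le_of_bounded_of_differentiableOn {E : Type*} [NormedAddCommGroup E]
    [NormedSpace ℂ E] {φ : E → E} {x₀ x y : E} {B : ℝ} (hφ : DifferentiableOn ℂ φ (ball x₀ 1))
    (hB : ∀ x ∈ ball x₀ 1, ‖φ x‖ ≤ B) (hx : x ∈ closedBall x₀ (1 / 4))
    (hy : y ∈ closedBall x₀ (1 / 4)) : ‖φ x - φ y‖ ≤ 4 * B * ‖x - y‖ := by
  rw [mem_closedBall] at hx hy
  have hsub : ball y (3 / 4) ⊆ ball x₀ 1 := ball_subset_ball' (by linarith)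
  have hyb : y ∈ ball x₀ 1 := hsub (mem_ball_self (by norm_num))
  have hB0 : 0 ≤ B := (norm_nonneg _).trans (hB y hyb)
  have hxy : x ∈ ball y (3 / 4) := by
    rw [mem_ball]
    have := dist_triangle_right x y x₀
    linarith
  have := Complex.dist_le_div_mul_dist_of_mapsTo_ball (R₂ := 2 * B) (hφ.mono hsub) (fun z hz => by
    rw [mem_closedBall, dist_eq_norm]
    have := norm_sub_le (φ z) (φ y)
    have := hB z (hsub hz)
    have := hB y hyb
    linarith) hxy
  rw [dist_eq_norm, dist_eq_norm] at this
  refine this.trans ?_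
  gcongr
  linarith

/-- The conditions under which the Picard iterates of `singularPicard` are defined. -/
structure IsSingularPicardIterate (Ω : Set ℂ) (c : ℂ) (f : ℂ → ℂ × ℂ) : Prop where
  diff : DifferentiableOn ℂ f Ω
  mem : ∀ s ∈ Ω, f s ∈ closedBall ((0 : ℂ), c) (1 / 4)

theorem differentiableOn_singularPicard_integrand
    (hg : DifferentiableOn ℂ (Function.uncurry g) (Ω ×ˢ ball (0, c) 1)) {f : ℂ → ℂ × ℂ}
    (hf : IsSingularPicardIterate Ω c f) : DifferentiableOn ℂ (fun z => g z (f z)) Ω :=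
  hg.comp (differentiableOn_id.prodMk hf.diff) fun s hs =>
    ⟨hs, closedBall_subset_ball (by norm_num) (hf.mem s hs)⟩

theorem norm_singularPicard_integrand_le
    (hb : ∀ s ∈ Ω, ∀ x ∈ ball ((0 : ℂ), c) 1, ‖g s x‖ ≤ C * Real.exp s.re) {f : ℂ → ℂ × ℂ}
    (hf : IsSingularPicardIterate Ω c f) {s : ℂ} (hs : s ∈ Ω) :
    ‖g s (f s)‖ ≤ C * Real.exp s.re :=
  hb s hs _ (closedBall_subset_ball (by norm_num) (hf.mem s hs))

theorem hasDerivAt_singularPicard (hΩ : IsOpen Ω) (hl : LeftInvariant Ω) (hk : 0 ≤ k)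
    (hg : DifferentiableOn ℂ (Function.uncurry g) (Ω ×ˢ ball (0, c) 1))
    (hb : ∀ s ∈ Ω, ∀ x ∈ ball ((0 : ℂ), c) 1, ‖g s x‖ ≤ C * Real.exp s.re)
    {f : ℂ → ℂ × ℂ} (hf : IsSingularPicardIterate Ω c f) {s : ℂ} (hs : s ∈ Ω) :
    HasDerivAt (singularPicard k c g f)
      ((g s (f s)).1 - k * (singularPicard k c g f s).1, (g s (f s)).2) s := by
  have hd := differentiableOn_singularPicard_integrand hg hf
  have hn := fun s (hs : s ∈ Ω) => norm_singularPicard_integrand_le hb hf hs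
  refine HasDerivAt.prodMk ?_ ?_
  · exact hasDerivAt_halfLineIntegral hΩ hl hk hd.fst
      (fun s hs => (norm_fst_le _).trans (hn s hs)) hs
  · have := (hasDerivAt_halfLineIntegral hΩ hl le_rfl hd.snd
      (fun s hs => (norm_snd_le _).trans (hn s hs)) hs).const_add c
    simpa using this

theorem norm_singularPicard_sub_le (hl : LeftInvariant Ω) (hk : 0 ≤ k)
    (hb : ∀ s ∈ Ω, ∀ x ∈ ball ((0 : ℂ), c) 1, ‖g s x‖ ≤ C * Real.exp s.re)
    {f : ℂ → ℂ × ℂ} (hf : IsSingularPicardIterate Ω c f) {s : ℂ} (hs : s ∈ Ω) :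
    ‖singularPicard k c g f s - (0, c)‖ ≤ C * Real.exp s.re := by
  have hn := fun s (hs : s ∈ Ω) => norm_singularPicard_integrand_le hb hf hs
  rw [singularPicard, Prod.mk_sub_mk, Prod.norm_mk, sub_zero, add_sub_cancel_left]
  exact max_le
    (norm_halfLineIntegral_le hl hk (fun s hs => (norm_fst_le _).trans (hn s hs)) hs)
    (norm_halfLineIntegral_le hl le_rfl (fun s hs => (norm_snd_le _).trans (hn s hs)) hs)

/-- The operator is a contraction for the supremum norm. -/
theorem norm_singularPicard_sub_singularPicard_le (hl : LeftInvariant Ω) (hk : 0 ≤ k)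
    (hg : DifferentiableOn ℂ (Function.uncurry g) (Ω ×ˢ ball (0, c) 1))
    (hb : ∀ s ∈ Ω, ∀ x ∈ ball ((0 : ℂ), c) 1, ‖g s x‖ ≤ C * Real.exp s.re)
    (hC : ∀ s ∈ Ω, C * Real.exp s.re ≤ 1 / 8)
    {f f' : ℂ → ℂ × ℂ} (hf : IsSingularPicardIterate Ω c f)
    (hf' : IsSingularPicardIterate Ω c f') {η : ℝ} (hη : ∀ s ∈ Ω, ‖f s - f' s‖ ≤ η) {s : ℂ}
    (hs : s ∈ Ω) :
    ‖singularPicard k c g f s - singularPicard k c g f' s‖ ≤ η / 2 := by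
  have hd := differentiableOn_singularPicard_integrand hg hf
  have hd' := differentiableOn_singularPicard_integrand hg hf'
  have hn := fun s (hs : s ∈ Ω) => norm_singularPicard_integrand_le hb hf hs
  have hn' := fun s (hs : s ∈ Ω) => norm_singularPicard_integrand_le hb hf' hs
  have hη0 : 0 ≤ η := (norm_nonneg _).trans (hη s hs)
  have hdiff : ∀ s ∈ Ω, ‖g s (f s) - g s (f' s)‖ ≤ 4 * C * η * Real.exp s.re := by
    intro s hs
    have h0 : 0 ≤ C * Real.exp s.re := (norm_nonneg _).trans (hn s hs)
    have := dist_le_of_bounded_of_differentiableOn (φ := g s) (x₀ := (0, c))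
      (hg.comp (f := fun x => (s, x)) (by fun_prop) fun x hx => ⟨hs, hx⟩)
      (hb s hs) (hf.mem s hs) (hf'.mem s hs)
    calc _ ≤ 4 * (C * Real.exp s.re) * ‖f s - f' s‖ := this
      _ ≤ 4 * (C * Real.exp s.re) * η := by gcongr; exact hη s hs
      _ = _ := by ring
  have hlin : ∀ (k : ℝ), 0 ≤ k → ∀ (φ : ℂ × ℂ → ℂ), (∀ x, ‖φ x‖ ≤ ‖x‖) →
      (∀ x y, φ (x - y) = φ x - φ y) → Continuous φ →
      ‖halfLineIntegral k (fun z => φ (g z (f z))) s -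
        halfLineIntegral k (fun z => φ (g z (f' z))) s‖ ≤ η / 2 := by
    intro k hk φ hφ hsub hc
    have h1 := integrableOn_halfLine hl hk (hc.comp_continuousOn hd.continuousOn)
      (fun s hs => (hφ _).trans (hn s hs)) hs
    have h2 := integrableOn_halfLine hl hk (hc.comp_continuousOn hd'.continuousOn)
      (fun s hs => (hφ _).trans (hn' s hs)) hs
    have h3 : halfLineIntegral k (fun z => φ (g z (f z))) s -
        halfLineIntegral k (fun z => φ (g z (f' z))) s =
        halfLineIntegral k (fun z => φ (g z (f z) - g z (f' z))) s := by
      simp only [halfLineIntegral, Function.comp_def] at h1 h2 ⊢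
      rw [← MeasureTheory.integral_sub h1 h2]
      simp only [hsub, mul_sub]
    rw [h3]
    refine (norm_halfLineIntegral_le hl hk (fun s hs => (hφ _).trans (hdiff s hs)) hs).trans ?_
    have := mul_le_mul_of_nonneg_right (hC s hs) hη0
    linarith
  rw [singularPicard, singularPicard, Prod.mk_sub_mk, Prod.norm_mk, add_sub_add_left_eq_sub]
  exact max_le (hlin k hk Prod.fst norm_fst_le (fun _ _ => rfl) continuous_fst)
    (hlin 0 le_rfl Prod.snd norm_snd_le (fun _ _ => rfl) continuous_snd)

/-- Existence for the singular initial value problem. A period of the equation is a period of the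
solution. -/
theorem exists_singularODE_solution (hΩ : IsOpen Ω) (hl : LeftInvariant Ω) (hk : 0 ≤ k)
    (hg : DifferentiableOn ℂ (Function.uncurry g) (Ω ×ˢ ball (0, c) 1))
    (hb : ∀ s ∈ Ω, ∀ x ∈ ball ((0 : ℂ), c) 1, ‖g s x‖ ≤ C * Real.exp s.re)
    (hC : ∀ s ∈ Ω, C * Real.exp s.re ≤ 1 / 8) :
    ∃ f : ℂ → ℂ × ℂ,
      (∀ s ∈ Ω, HasDerivAt f ((g s (f s)).1 - k * (f s).1, (g s (f s)).2) s) ∧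
      (∀ s ∈ Ω, f s ∈ ball ((0 : ℂ), c) 1) ∧
      (∀ s ∈ Ω, ‖f s - (0, c)‖ ≤ C * Real.exp s.re) ∧
      ∀ ω : ℂ, (∀ s ∈ Ω, s + ω ∈ Ω ∧ ∀ x, g (s + ω) x = g s x) → ∀ s ∈ Ω, f (s + ω) = f s := by
  set T := singularPicard k c g with hT
  let F : ℕ → ℂ → ℂ × ℂ := fun j => T^[j] fun _ => (0, c)
  have hF1 : ∀ j, F (j + 1) = T (F j) := fun j => Function.iterate_succ_apply' T j _
  have hTit : ∀ f, IsSingularPicardIterate Ω c f → IsSingularPicardIterate Ω c (T f) := by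
    intro f hf
    refine ⟨fun s hs => (hasDerivAt_singularPicard hΩ hl hk hg hb hf
      hs).differentiableAt.differentiableWithinAt, fun s hs => ?_⟩
    rw [mem_closedBall, dist_eq_norm]
    have := norm_singularPicard_sub_le hl hk hb hf hs
    linarith [hC s hs]
  have hit : ∀ j, IsSingularPicardIterate Ω c (F j) := by
    intro j
    induction j with
    | zero => exact ⟨differentiableOn_const _, fun s _ => mem_closedBall_self (by norm_num)⟩
    | succ j ih => rw [hF1]; exact hTit _ ih
  have hstep : ∀ j, ∀ s ∈ Ω, ‖F j s - F (j + 1) s‖ ≤ 1 / 2 / 2 ^ j := by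
    intro j
    induction j with
    | zero =>
      intro s hs
      have h1 := (hit 1).mem s hs
      rw [mem_closedBall, dist_comm, dist_eq_norm] at h1
      exact h1.trans (by norm_num)
    | succ j ih =>
      intro s hs
      have := norm_singularPicard_sub_singularPicard_le hl hk hg hb hC (hit j) (hit (j + 1)) ih hs
      rw [hF1 j, hF1 (j + 1)]
      refine this.trans_eq ?_
      rw [pow_succ]
      ring
  have hcs : ∀ s ∈ Ω, ∃ y, Tendsto (fun j => F j s) atTop (𝓝 y) := fun s hs =>
    cauchySeq_tendsto_of_complete <| cauchySeq_of_le_geometric_two (C := 1) fun j => by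
      rw [dist_eq_norm]
      exact hstep j s hs
  choose! f hf using hcs
  have hdist : ∀ j, ∀ s ∈ Ω, ‖F j s - f s‖ ≤ 1 / 2 ^ j := fun j s hs => by
    rw [← dist_eq_norm]
    exact dist_le_of_le_geometric_two_of_tendsto (fun j => by
      rw [dist_eq_norm]
      exact hstep j s hs) (hf s hs) j
  have hunif : TendstoUniformlyOn F f atTop Ω := by
    rw [Metric.tendstoUniformlyOn_iff]
    intro η hη
    have : Tendsto (fun j : ℕ => 1 / (2 : ℝ) ^ j) atTop (𝓝 0) := by
      simpa using tendsto_pow_atTop_nhds_zero_of_lt_one (r := (1 / 2 : ℝ)) (by norm_num)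
        (by norm_num)
    filter_upwards [this.eventually_lt_const hη] with j hj s hs
    rw [dist_comm, dist_eq_norm]
    exact (hdist j s hs).trans_lt hj
  have hfit : IsSingularPicardIterate Ω c f :=
    ⟨hunif.tendstoLocallyUniformlyOn.differentiableOn (Eventually.of_forall fun j => (hit j).diff)
      hΩ, fun s hs => isClosed_closedBall.mem_of_tendsto (hf s hs)
        (Eventually.of_forall fun j => (hit j).mem s hs)⟩
  have hfix : ∀ s ∈ Ω, T f s = f s := by
    intro s hs
    have h0 : Tendsto (fun j : ℕ => 1 / (2 : ℝ) ^ j / 2) atTop (𝓝 0) := by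
      have := (tendsto_pow_atTop_nhds_zero_of_lt_one (r := (1 / 2 : ℝ)) (by norm_num)
        (by norm_num)).div_const 2
      simpa using this
    have h1 : Tendsto (fun j => F (j + 1) s) atTop (𝓝 (T f s)) := by
      rw [tendsto_iff_norm_sub_tendsto_zero]
      refine squeeze_zero (fun _ => norm_nonneg _) (fun j => ?_) h0
      rw [hF1]
      exact norm_singularPicard_sub_singularPicard_le hl hk hg hb hC (hit j) hfit (hdist j) hs
    exact tendsto_nhds_unique h1 ((tendsto_add_atTop_iff_nat 1).2 (hf s hs))
  refine ⟨f, fun s hs => ?_, fun s hs => closedBall_subset_ball (by norm_num) (hfit.mem s hs),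
    fun s hs => ?_, fun ω hω s hs => ?_⟩
  · have h1 := hasDerivAt_singularPicard hΩ hl hk hg hb hfit hs
    rw [← hT, hfix s hs] at h1
    refine h1.congr_of_eventuallyEq ?_
    filter_upwards [hΩ.mem_nhds hs] with z hz
    exact (hfix z hz).symm
  · rw [← hfix s hs]
    exact norm_singularPicard_sub_le hl hk hb hfit hs
  · have hper : ∀ j, ∀ s ∈ Ω, F j (s + ω) = F j s := by
      intro j
      induction j with
      | zero => exact fun s _ => rfl
      | succ j ih =>
        intro s hs
        rw [hF1, hT]
        have hh : ∀ k : ℝ, ∀ φ : ℂ × ℂ → ℂ, halfLineIntegral k (fun z => φ (g z (F j z))) (s + ω) =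
            halfLineIntegral k (fun z => φ (g z (F j z))) s := by
          intro k φ
          refine MeasureTheory.setIntegral_congr_fun measurableSet_Iic fun r hr => ?_
          have hsr := hl s hs r hr
          have e : s + ω + r = s + r + ω := by ring
          simp only [e]
          rw [ih _ hsr, (hω _ hsr).2]
        simp only [singularPicard]
        rw [hh k Prod.fst, hh 0 Prod.snd]
    refine tendsto_nhds_unique (hf _ (hω s hs).1) ?_
    simp only [hper _ s hs]
    exact hf s hs

end SingularODE

/-! ### The determinants at infinity -/

namespace QuadricConstants

section AtInfinity

variable {n : ℕ} (d : QuadricConstants n)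

/-- The squared Euclidean norm of `ε`. -/
noncomputable def normSqε : ℂ := ∑ i, (d.ε i : ℂ) ^ 2

theorem normSqε_ne_zero (hε : d.ε ≠ 0) : d.normSqε ≠ 0 := by
  have h : d.normSqε = ((∑ i, d.ε i ^ 2 : ℝ) : ℂ) := by simp [normSqε]
  rw [h]
  obtain ⟨i, hi⟩ := Function.ne_iff.1 hε
  have : 0 < ∑ i, d.ε i ^ 2 :=
    Finset.sum_pos' (fun i _ => sq_nonneg _) ⟨i, Finset.mem_univ i, sq_pos_of_ne_zero hi⟩
  exact_mod_cast this.ne'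

/-- The matrix whose determinant is `w ^ (n - 1) Q (1 / w)` when `φ = 0`. -/
noncomputable def borderInf (w : ℂ) : Matrix (Fin n ⊕ Unit) (Fin n ⊕ Unit) ℂ :=
  Matrix.fromBlocks ((-2 : ℂ) • (1 : Matrix (Fin n) (Fin n) ℂ) + w • d.X₀.map fun x : ℝ => (x : ℂ))
    (Matrix.of fun i _ => (d.ε i : ℂ)) (Matrix.of fun _ j => (d.ε j : ℂ)) 0

/-- The matrix `w N (0, 1 / w)` when `φ = 0`, with its entries extended to `w = 0`. -/
noncomputable def NInf (w : ℂ) : Matrix (Unit ⊕ (Fin n ⊕ Unit)) (Unit ⊕ (Fin n ⊕ Unit)) ℂ :=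
  Matrix.fromBlocks 0
    (Matrix.of fun _ j => Sum.elim (fun i => w * (d.β i : ℂ)) (fun _ => 1) j)
    (Matrix.of fun i _ => Sum.elim (fun i => w * (d.β i : ℂ)) (fun _ => 1) i)
    (Matrix.fromBlocks
      ((-2 : ℂ) • (1 : Matrix (Fin n) (Fin n) ℂ) + w • d.X₀.map fun x : ℝ => (x : ℂ))
      (Matrix.of fun i _ => w * (d.ε i : ℂ)) (Matrix.of fun _ j => w * (d.ε j : ℂ)) 0)

/-- The reversed polynomial `w ^ (n - 1) Q (1 / w)`. -/
noncomputable def QInf (w : ℂ) : ℂ := (d.borderInf w).det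

/-- The reversed polynomial `w ^ (n + 2) L (1 / w)`. -/
noncomputable def LInf (w : ℂ) : ℂ := (d.NInf w).det

theorem mul_Q_eq (hφ : d.φ = 0) {z : ℂ} (hz : z ≠ 0) : z * d.Q z = z ^ n * d.QInf z⁻¹ := by
  have h : d.border z = Matrix.diagonal (Sum.elim (fun _ => z) fun _ => 1) * d.borderInf z⁻¹ *
      Matrix.diagonal (Sum.elim (fun _ => 1) fun _ => z⁻¹) := by
    ext i j
    rcases i with i | i <;> rcases j with j | j <;>
      simp [border, borderInf, X, hφ, Matrix.mul_apply, Matrix.diagonal_apply] <;>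
      field_simp
  rw [Q, h, Matrix.det_mul, Matrix.det_mul, Matrix.det_diagonal, Matrix.det_diagonal, QInf]
  simp
  field_simp

theorem L_eq (hφ : d.φ = 0) {z : ℂ} (hz : z ≠ 0) : d.L z = z ^ (n + 2) * d.LInf z⁻¹ := by
  have h : d.N 0 z = z • d.NInf z⁻¹ := by
    ext i j
    rcases i with i | i | i <;> rcases j with j | j | j <;>
      simp [N, NInf, border, X, hφ] <;> field_simp
  rw [L, h, Matrix.det_smul, LInf]
  simp [add_left_comm]

theorem QInf_zero : d.QInf 0 = (-2) ^ n * (d.normSqε / 2) := by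
  have h : d.borderInf 0 * Matrix.fromBlocks 1 (Matrix.of fun i _ => (d.ε i : ℂ) / 2) 0 1 =
      Matrix.fromBlocks ((-2 : ℂ) • (1 : Matrix (Fin n) (Fin n) ℂ)) 0
        (Matrix.of fun _ j => (d.ε j : ℂ)) (Matrix.of fun _ _ => d.normSqε / 2) := by
    rw [borderInf, Matrix.fromBlocks_multiply]
    congr 1
    · simp
    · ext i j
      simp
      ring
    · simp
    · ext i j
      simp [Matrix.mul_apply, normSqε, Finset.sum_div, sq, mul_div_assoc]
  have h2 := congrArg Matrix.det h
  rw [Matrix.det_mul, Matrix.det_fromBlocks_zero₂₁, Matrix.det_fromBlocks_zero₁₂,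
    Matrix.det_smul] at h2
  simpa [QInf] using h2

theorem LInf_zero : d.LInf 0 = -(-2) ^ n := by
  have h : (d.NInf 0).submatrix id (Equiv.swap (Sum.inl ()) (Sum.inr (Sum.inr ()))) =
      Matrix.fromBlocks 1 0 0
        (Matrix.fromBlocks ((-2 : ℂ) • (1 : Matrix (Fin n) (Fin n) ℂ)) 0 0 1) := by
    ext i j
    rcases i with i | i | i <;> rcases j with j | j | j <;>
      simp [NInf, Equiv.swap_apply_def]
  have h2 := congrArg Matrix.det h
  rw [Matrix.det_permute', Equiv.Perm.sign_swap (by simp), Matrix.det_fromBlocks_zero₂₁,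
    Matrix.det_fromBlocks_zero₂₁, Matrix.det_smul] at h2
  simp at h2
  rw [LInf, ← h2, neg_neg]

theorem differentiable_QInf : Differentiable ℂ d.QInf := by
  have h : ∀ i j, Differentiable ℂ fun w => d.borderInf w i j := by
    rintro (i | i) (j | j) <;> (simp [borderInf]; try fun_prop)
  unfold QInf
  simp only [Matrix.det_apply]
  fun_prop

theorem differentiable_LInf : Differentiable ℂ d.LInf := by
  have h : ∀ i j, Differentiable ℂ fun w => d.NInf w i j := by
    rintro (i | i | i) (j | j | j) <;> (simp [NInf]; try fun_prop)
  unfold LInf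
  simp only [Matrix.det_apply]
  fun_prop

/-- With `w = 1 / Z`, the function `det N = Y Q(Z) + L(Z)` at `Y = H - 2 u Z`, divided by its
leading term `-(-2) ^ n Z ^ (n + 2)`. -/
noncomputable def radicand (u H w : ℂ) : ℂ :=
  (d.LInf w + (H * w ^ 3 - 2 * u * w ^ 2) * d.QInf w) / -(-2) ^ n

theorem mul_Q_add_L_eq (hφ : d.φ = 0) (u H : ℂ) {z : ℂ} (hz : z ≠ 0) :
    (H - 2 * u * z) * d.Q z + d.L z = -(-2) ^ n * z ^ (n + 2) * d.radicand u H z⁻¹ := by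
  have h2 : -(-2 : ℂ) ^ n ≠ 0 := by simp
  have h3 := d.mul_Q_eq hφ hz
  rw [d.L_eq hφ hz, radicand]
  generalize d.QInf z⁻¹ = q at *
  generalize d.LInf z⁻¹ = l at *
  apply mul_left_cancel₀ hz
  field_simp
  linear_combination (H - 2 * u * z) * z ^ 2 * h3

theorem Q_ne_zero (hφ : d.φ = 0) {z : ℂ} (hz : z ≠ 0) (h : d.QInf z⁻¹ ≠ 0) : d.Q z ≠ 0 := by
  intro h0
  have := d.mul_Q_eq hφ hz
  simp [h0, hz, h] at this

theorem exists_norm_radicand_sub_one_le :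
    ∃ C : ℝ, 0 < C ∧ ∀ u H w : ℂ, ‖w‖ ≤ 1 →
      ‖d.radicand u H w - 1‖ ≤ C * (‖w‖ + ‖u‖ * ‖w‖ ^ 2 + ‖H‖ * ‖w‖ ^ 3) := by
  have h2 : -(-2 : ℂ) ^ n ≠ 0 := by simp
  obtain ⟨C₁, hC₁⟩ := (isCompact_closedBall (0 : ℂ) 1).exists_bound_of_continuousOn
    (f := dslope d.LInf 0)
    ((Complex.differentiableOn_dslope (Filter.univ_mem)).2
      d.differentiable_LInf.differentiableOn |>.continuousOn.mono (Set.subset_univ _))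
  obtain ⟨C₂, hC₂⟩ := (isCompact_closedBall (0 : ℂ) 1).exists_bound_of_continuousOn
    (f := d.QInf) d.differentiable_QInf.continuous.continuousOn
  have hpos : 0 < ‖-(-2 : ℂ) ^ n‖ := norm_pos_iff.2 h2
  have h01 : (0 : ℂ) ∈ Metric.closedBall (0 : ℂ) 1 := by simp
  have hC₁0 := (norm_nonneg _).trans (hC₁ 0 h01)
  have hC₂0 := (norm_nonneg _).trans (hC₂ 0 h01)
  refine ⟨(C₁ + 2 * C₂ + 1) / ‖-(-2 : ℂ) ^ n‖, by positivity, fun u H w hw => ?_⟩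
  have hw1 : w ∈ Metric.closedBall (0 : ℂ) 1 := by simpa using hw
  have e : d.radicand u H w - 1 =
      (w * dslope d.LInf 0 w + (H * w ^ 3 - 2 * u * w ^ 2) * d.QInf w) / -(-2) ^ n := by
    have h3 := sub_smul_dslope d.LInf 0 w
    rw [LInf_zero, sub_zero, smul_eq_mul] at h3
    rw [h3, radicand]
    field_simp
    ring
  rw [e, norm_div, div_mul_eq_mul_div]
  gcongr
  calc _ ≤ ‖w‖ * ‖dslope d.LInf 0 w‖ + (‖H‖ * ‖w‖ ^ 3 + 2 * ‖u‖ * ‖w‖ ^ 2) * ‖d.QInf w‖ := by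
        refine (norm_add_le _ _).trans ?_
        rw [norm_mul, norm_mul]
        gcongr
        refine (norm_sub_le _ _).trans ?_
        simp
    _ ≤ ‖w‖ * C₁ + (‖H‖ * ‖w‖ ^ 3 + 2 * ‖u‖ * ‖w‖ ^ 2) * C₂ := by
        gcongr
        · exact hC₁ w hw1
        · exact hC₂ w hw1
    _ ≤ _ := by
        have := norm_nonneg w
        have h5 : 0 ≤ ‖H‖ * ‖w‖ ^ 3 := by positivity
        have h6 : 0 ≤ ‖u‖ * ‖w‖ ^ 2 := by positivity
        nlinarith [mul_nonneg this hC₂0, mul_nonneg h5 hC₁0, mul_nonneg h5 hC₂0,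
          mul_nonneg h6 hC₁0]

theorem exists_QInf_ne_zero (hε : d.ε ≠ 0) : ∃ ρ : ℝ, 0 < ρ ∧ ∀ w : ℂ, ‖w‖ < ρ → d.QInf w ≠ 0 := by
  have h0 : d.QInf 0 ≠ 0 := by
    rw [QInf_zero]
    simp [d.normSqε_ne_zero hε]
  have := d.differentiable_QInf.continuous.continuousAt.eventually_ne h0
  obtain ⟨ρ, hρ, h⟩ := Metric.eventually_nhds_iff.1 this
  exact ⟨ρ, hρ, fun w hw => h (by simpa using hw)⟩

end AtInfinity

end QuadricConstants

/-! ### The equation in the parameter `s` with `u = u₀ + e^{ns}` -/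

/-- A principal square root close to `1`. -/
theorem sqrt_near_one {z : ℂ} (hz : ‖z - 1‖ ≤ 1 / 2) :
    z ∈ Complex.slitPlane ∧ (z ^ (1 / 2 : ℂ)) ^ 2 = z ∧ z ^ (1 / 2 : ℂ) ≠ 0 ∧
      ‖z ^ (1 / 2 : ℂ) - 1‖ ≤ ‖z - 1‖ := by
  have hre : 1 / 2 ≤ z.re := by
    have := (abs_le.1 ((Complex.abs_re_le_norm _).trans hz)).1
    simp at this
    linarith
  have hs : z ∈ Complex.slitPlane := Or.inl (by linarith)
  have hsq : (z ^ (1 / 2 : ℂ)) ^ 2 = z := by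
    rw [← Complex.cpow_nat_mul]
    norm_num
  have h0 : z ≠ 0 := Complex.slitPlane_ne_zero hs
  refine ⟨hs, hsq, fun h => h0 (by rw [← hsq, h]; simp), ?_⟩
  have hpos : 0 ≤ (z ^ (1 / 2 : ℂ)).re := by
    rw [Complex.cpow_def_of_ne_zero h0, Complex.exp_re]
    have h1 : (Complex.log z * (1 / 2)).im = Complex.arg z / 2 := by
      rw [show Complex.log z * (1 / 2) = Complex.log z * ((1 / 2 : ℝ) : ℂ) by norm_num,
        Complex.im_mul_ofReal, Complex.log_im]
      ring
    rw [h1]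
    have h2 := Complex.arg_le_pi z
    have h3 := Complex.neg_pi_lt_arg z
    exact mul_nonneg (Real.exp_pos _).le
      (Real.cos_nonneg_of_neg_pi_div_two_le_of_le (by linarith) (by linarith))
  have h1 : 1 ≤ ‖z ^ (1 / 2 : ℂ) + 1‖ := by
    have := Complex.re_le_norm (z ^ (1 / 2 : ℂ) + 1)
    simp only [Complex.add_re, Complex.one_re] at this
    linarith
  have h2 : z - 1 = (z ^ (1 / 2 : ℂ) - 1) * (z ^ (1 / 2 : ℂ) + 1) := by
    linear_combination -hsq
  rw [h2, norm_mul]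
  exact le_mul_of_one_le_right (norm_nonneg _) h1

theorem norm_cpow_le_two {z : ℂ} (hz : ‖z - 1‖ ≤ 1 / 2) {θ : ℝ} (h0 : 0 ≤ θ) (h1 : θ ≤ 1) :
    ‖z ^ (θ : ℂ)‖ ≤ 2 ∧ ‖z ^ (-θ : ℂ)‖ ≤ 2 := by
  have hlow : 1 / 2 ≤ ‖z‖ := by
    have := norm_sub_norm_le (1 : ℂ) (1 - z)
    rw [sub_sub_cancel, norm_one, norm_sub_rev] at this
    linarith
  have hup : ‖z‖ ≤ 2 := by
    have := norm_add_le (z - 1) 1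
    rw [sub_add_cancel, norm_one] at this
    linarith
  constructor
  · rw [Complex.norm_cpow_real]
    calc ‖z‖ ^ θ ≤ 2 ^ θ := Real.rpow_le_rpow (norm_nonneg _) hup h0
      _ ≤ 2 ^ (1 : ℝ) := Real.rpow_le_rpow_of_exponent_le (by norm_num) h1
      _ = 2 := Real.rpow_one 2
  · rw [← Complex.ofReal_neg, Complex.norm_cpow_real, Real.rpow_neg (norm_nonneg _)]
    have h2 : (2⁻¹ : ℝ) ≤ ‖z‖ ^ θ := by
      calc (2⁻¹ : ℝ) = 2⁻¹ ^ (1 : ℝ) := (Real.rpow_one _).symm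
        _ ≤ 2⁻¹ ^ θ := Real.rpow_le_rpow_of_exponent_ge (by norm_num) (by norm_num) h1
        _ ≤ ‖z‖ ^ θ := Real.rpow_le_rpow (by norm_num) (by linarith) h0
    exact inv_le_of_inv_le₀ (by norm_num) h2

namespace QuadricConstants

section Parametrized

variable {n : ℕ} (d : QuadricConstants n)

/-- The system `det N = 4 ζ (dW/du)²`, `Y' + 2 u W' = 0`, written with `H = Y + 2 u W` in a
parameter `s` of `u = p s`, implies the second order equation. -/
theorem isSolutionAlong_of_system {Ω : Set ℂ} (hΩ : IsOpen Ω) {p W H : ℂ → ℂ}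
    (hp : DifferentiableOn ℂ p Ω) (hW : DifferentiableOn ℂ W Ω)
    (hp' : ∀ s ∈ Ω, deriv p s ≠ 0) (hW' : ∀ s ∈ Ω, deriv W s ≠ 0) (hQ : ∀ s ∈ Ω, d.Q (W s) ≠ 0)
    (hH : ∀ s ∈ Ω, HasDerivAt H (2 * deriv p s * W s) s)
    (h2 : ∀ s ∈ Ω, 4 * d.ζ * (deriv W s / deriv p s) ^ 2 =
      (H s - 2 * p s * W s) * d.Q (W s) + d.L (W s)) :
    (d.reducedODE 1).IsSolutionAlong p Ω W := by
  refine ⟨hp, hW, fun s hs => ⟨hp' s hs, hQ s hs, ?_⟩⟩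
  have hζ : (d.ζ : ℂ) ≠ 0 := by exact_mod_cast d.ζ_ne
  have nΩ := hΩ.mem_nhds hs
  have dW := (hW.differentiableAt nΩ).hasDerivAt
  have dp := (hp.differentiableAt nΩ).hasDerivAt
  have dD := ((hW.deriv hΩ).differentiableAt nΩ).fun_div ((hp.deriv hΩ).differentiableAt nΩ)
    (hp' s hs) |>.hasDerivAt
  have dQ := (d.differentiable_Q (W s)).hasDerivAt.comp s dW
  have dL := (d.differentiable_L (W s)).hasDerivAt.comp s dW
  have e : (fun x => 4 * (d.ζ : ℂ) * (deriv W x / deriv p x) ^ 2) =ᶠ[𝓝 s]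
      fun x => (H x - 2 * p x * W x) * d.Q (W x) + d.L (W x) := by
    filter_upwards [nΩ] with x hx
    exact h2 x hx
  have k1 := (((((hH s hs).sub ((dp.const_mul 2).mul dW)).mul dQ).add dL).congr_of_eventuallyEq
    e).unique ((dD.pow 2).const_mul (4 * (d.ζ : ℂ)))
  have k3 := h2 s hs
  have q := hQ s hs
  simp only [reducedODE, logDeriv_apply]
  set D' := deriv (fun x => deriv W x / deriv p x) s with hD'
  obtain ⟨D, hD⟩ : ∃ D, D = deriv W s / deriv p s := ⟨_, rfl⟩
  have hWD : deriv W s = D * deriv p s := by rw [hD, div_mul_cancel₀ _ (hp' s hs)]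
  have hD0 : D ≠ 0 := by rw [hD]; exact div_ne_zero (hW' s hs) (hp' s hs)
  have p0 := hp' s hs
  simp only [Function.comp_apply, Pi.mul_apply, Pi.sub_apply] at k1
  norm_num at k1
  rw [← hD] at k1 k3 ⊢
  rw [hWD] at k1
  generalize deriv p s = P at *
  generalize deriv d.Q (W s) = Q' at *
  generalize deriv d.L (W s) = L' at *
  generalize d.Q (W s) = Q at *
  generalize d.L (W s) = L at *
  have k4 : 8 * d.ζ * D' = P * (-2 * p s * Q + (H s - 2 * p s * W s) * Q' + L') := by
    apply mul_left_cancel₀ hD0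
    linear_combination -k1
  field_simp
  linear_combination 8 * Q * k4 - 8 * P * Q' * k3

/-- The function `Z = a e^{-2s} E^{-2/n}`; `E` is the `n`-th power of the ratio of `Z ^ (-1/2)` to
its leading term. -/
noncomputable def branchFun (n : ℕ) (a : ℂ) (s E : ℂ) : ℂ :=
  a * Complex.exp (-2 * s) * E ^ (-((2 / n : ℝ) : ℂ))

/-- The quadric system for `Z = branchFun n a s E` in the parameter `s`, `u = u₀ + e^{ns}`: the
functions `E`, `H` solve a first order system in which `S` is the square root of the radicand. -/
structure IsBranchSystem (a u₀ : ℂ) (Ω : Set ℂ) (E S H : ℂ → ℂ) : Prop where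
  norm_E_sub_one_le : ∀ s ∈ Ω, ‖E s - 1‖ ≤ 1 / 2
  S_ne_zero : ∀ s ∈ Ω, S s ≠ 0
  S_sq : ∀ s ∈ Ω, S s ^ 2 =
    d.radicand (u₀ + Complex.exp (n * s)) (H s) (branchFun n a s (E s))⁻¹
  hasDerivAt_E : ∀ s ∈ Ω, HasDerivAt E (n * (S s - E s)) s
  hasDerivAt_H : ∀ s ∈ Ω,
    HasDerivAt H (2 * (n * Complex.exp (n * s)) * branchFun n a s (E s)) s
  QInf_ne_zero : ∀ s ∈ Ω, d.QInf (branchFun n a s (E s))⁻¹ ≠ 0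

theorem mem_slitPlane_of_norm_sub_one_le {z : ℂ} (hz : ‖z - 1‖ ≤ 1 / 2) :
    z ∈ Complex.slitPlane := (sqrt_near_one hz).1

namespace IsBranchSystem

variable {d} {a u₀ : ℂ} {Ω : Set ℂ} {E S H : ℂ → ℂ}

theorem E_mem (h : d.IsBranchSystem a u₀ Ω E S H) {s : ℂ} (hs : s ∈ Ω) :
    E s ∈ Complex.slitPlane := mem_slitPlane_of_norm_sub_one_le (h.norm_E_sub_one_le s hs)

theorem branchFun_ne_zero (h : d.IsBranchSystem a u₀ Ω E S H) (ha : a ≠ 0) {s : ℂ} (hs : s ∈ Ω) :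
    branchFun n a s (E s) ≠ 0 := by
  have := Complex.slitPlane_ne_zero (h.E_mem hs)
  simp [branchFun, ha, this, Complex.cpow_eq_zero_iff]

theorem hasDerivAt_branchFun (h : d.IsBranchSystem a u₀ Ω E S H) (hn : n ≠ 0) {s : ℂ}
    (hs : s ∈ Ω) : HasDerivAt (fun s => branchFun n a s (E s))
      (-2 * branchFun n a s (E s) * S s / E s) s := by
  have h1 : HasDerivAt (fun s : ℂ => Complex.exp (-2 * s)) (Complex.exp (-2 * s) * -2) s := by
    simpa using ((hasDerivAt_id s).const_mul (-2 : ℂ)).cexp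
  have h2 := (h.hasDerivAt_E s hs).cpow_const (c := -((2 / n : ℝ) : ℂ)) (h.E_mem hs)
  have h0 := Complex.slitPlane_ne_zero (h.E_mem hs)
  have hn' : (n : ℂ) ≠ 0 := by exact_mod_cast hn
  refine ((h1.const_mul a).mul h2).congr_deriv ?_
  rw [Complex.cpow_sub _ _ h0, Complex.cpow_one, branchFun]
  generalize E s ^ (-((2 / n : ℝ) : ℂ)) = x
  push_cast
  field_simp
  ring

theorem hasDerivAt_param (n : ℕ) (u₀ s : ℂ) :
    HasDerivAt (fun s : ℂ => u₀ + Complex.exp (n * s)) (n * Complex.exp (n * s)) s := by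
  have := (((hasDerivAt_id s).const_mul (n : ℂ)).cexp).const_add u₀
  simpa [mul_comm] using this

theorem quadric (h : d.IsBranchSystem a u₀ Ω E S H) (hn : n ≠ 0) (hφ : d.φ = 0)
    (ha : a ^ n = -16 * d.ζ / (n ^ 2 * (-2) ^ n)) (ha0 : a ≠ 0) {s : ℂ} (hs : s ∈ Ω) :
    4 * d.ζ * (deriv (fun s => branchFun n a s (E s)) s /
        deriv (fun s : ℂ => u₀ + Complex.exp (n * s)) s) ^ 2 =
      (H s - 2 * (u₀ + Complex.exp (n * s)) * branchFun n a s (E s)) *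
        d.Q (branchFun n a s (E s)) + d.L (branchFun n a s (E s)) := by
  have h0 := Complex.slitPlane_ne_zero (h.E_mem hs)
  have hn' : (n : ℂ) ≠ 0 := by exact_mod_cast hn
  have hW0 := h.branchFun_ne_zero ha0 hs
  rw [d.mul_Q_add_L_eq hφ _ _ hW0, ← h.S_sq s hs,
    (h.hasDerivAt_branchFun hn hs).deriv, (hasDerivAt_param n u₀ s).deriv]
  have hWn : branchFun n a s (E s) ^ n * (Complex.exp (n * s) ^ 2 * E s ^ 2) = a ^ n := by
    have e1 : (E s ^ (-((2 / n : ℝ) : ℂ))) ^ n * E s ^ 2 = 1 := by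
      rw [← Complex.cpow_nat_mul,
        show (n : ℂ) * -((2 / n : ℝ) : ℂ) = -((2 : ℕ) : ℂ) by push_cast; field_simp,
        Complex.cpow_neg, Complex.cpow_natCast]
      field_simp
    have e2 : Complex.exp (-2 * s) ^ n * Complex.exp (n * s) ^ 2 = 1 := by
      rw [← Complex.exp_nat_mul, ← Complex.exp_nat_mul, ← Complex.exp_add, ← Complex.exp_zero]
      congr 1
      push_cast
      ring
    rw [branchFun, mul_pow, mul_pow]
    linear_combination a ^ n * (E s ^ (-((2 / n : ℝ) : ℂ))) ^ n * E s ^ 2 * e2 + a ^ n * e1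
  have h2n : (-2 : ℂ) ^ n ≠ 0 := by simp
  have he := Complex.exp_ne_zero (n * s)
  rw [ha, eq_div_iff (by simp [hn])] at hWn
  rw [pow_add]
  generalize branchFun n a s (E s) = w at *
  field_simp
  linear_combination S s ^ 2 * hWn

theorem isSolutionAlong (h : d.IsBranchSystem a u₀ Ω E S H) (hΩ : IsOpen Ω) (hn : n ≠ 0)
    (hφ : d.φ = 0) (ha : a ^ n = -16 * d.ζ / (n ^ 2 * (-2) ^ n)) (ha0 : a ≠ 0) :
    (d.reducedODE 1).IsSolutionAlong (fun s : ℂ => u₀ + Complex.exp (n * s)) Ω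
      (fun s => branchFun n a s (E s)) := by
  have hn' : (n : ℂ) ≠ 0 := by exact_mod_cast hn
  refine d.isSolutionAlong_of_system hΩ (H := H) (by fun_prop)
    (fun s hs => (h.hasDerivAt_branchFun hn hs).differentiableAt.differentiableWithinAt)
    (fun s _ => ?_) (fun s hs => ?_)
    (fun s hs => d.Q_ne_zero hφ (h.branchFun_ne_zero ha0 hs) (h.QInf_ne_zero s hs))
    (fun s hs => ?_) (fun s hs => h.quadric hn hφ ha ha0 hs)
  · rw [(hasDerivAt_param n u₀ s).deriv]
    exact mul_ne_zero hn' (Complex.exp_ne_zero _)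
  · rw [(h.hasDerivAt_branchFun hn hs).deriv]
    exact div_ne_zero (mul_ne_zero (mul_ne_zero (by norm_num) (h.branchFun_ne_zero ha0 hs))
      (h.S_ne_zero s hs)) (Complex.slitPlane_ne_zero (h.E_mem hs))
  · rw [(hasDerivAt_param n u₀ s).deriv]
    exact h.hasDerivAt_H s hs

end IsBranchSystem

end Parametrized

end QuadricConstants

/-! ### Existence of solutions with a branch point -/

namespace QuadricConstants

section Existence

variable {n : ℕ} (d : QuadricConstants n)

/-- The coefficient of `s` in `H`, which is non-zero only for `n = 2`: the source of the
logarithm. -/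
noncomputable def logCoeff (n : ℕ) (a : ℂ) : ℂ := if n = 2 then 4 * a else 0

/-- The radicand as a function of `s` and of the unknowns `x = (ξ, G)`, where `E = 1 + e^s ξ` and
`H = logCoeff n a * s + G`. -/
noncomputable def shiftedRadicand (a u₀ s : ℂ) (x : ℂ × ℂ) : ℂ :=
  d.radicand (u₀ + Complex.exp (n * s)) (logCoeff n a * s + x.2)
    (branchFun n a s (1 + Complex.exp s * x.1))⁻¹

/-- The right-hand side of the system `ξ' = g₁ - (n + 1) ξ`, `G' = g₂`. -/
noncomputable def shiftedRHS (a u₀ s : ℂ) (x : ℂ × ℂ) : ℂ × ℂ :=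
  (n * Complex.exp (-s) * (d.shiftedRadicand a u₀ s x ^ (1 / 2 : ℂ) - 1),
    2 * (n * Complex.exp (n * s)) * branchFun n a s (1 + Complex.exp s * x.1) - logCoeff n a)

/-- The estimates that hold for unknowns `x` in the unit ball around `(0, c)` when `Re s` is
sufficiently negative. -/
structure IsSmallAt (a u₀ : ℂ) (C : ℝ) (s : ℂ) (x : ℂ × ℂ) : Prop where
  norm_E_sub_one_le : ‖(1 + Complex.exp s * x.1) - 1‖ ≤ 1 / 2
  norm_radicand_sub_one_le : ‖d.shiftedRadicand a u₀ s x - 1‖ ≤ 1 / 2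
  norm_sqrt_sub_one_le :
    ‖d.shiftedRadicand a u₀ s x ^ (1 / 2 : ℂ) - 1‖ ≤ C * Real.exp s.re
  QInf_ne_zero : d.QInf (branchFun n a s (1 + Complex.exp s * x.1))⁻¹ ≠ 0
  norm_RHS_le : ‖d.shiftedRHS a u₀ s x‖ ≤ C * Real.exp s.re

theorem inv_branchFun (n : ℕ) (a s E : ℂ) :
    (branchFun n a s E)⁻¹ = a⁻¹ * Complex.exp (2 * s) * E ^ ((2 / n : ℝ) : ℂ) := by
  rw [branchFun, mul_inv, mul_inv, Complex.cpow_neg, inv_inv, ← Complex.exp_neg]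
  ring_nf

/-- The forcing of `H` after removal of its constant part is of order `e^s`. -/
theorem norm_forcing_le (hn : 2 ≤ n) (a : ℂ) {s ξ : ℂ} (hs : s.re ≤ 0) (hξ : ‖ξ‖ ≤ 1)
    (hE : ‖(1 + Complex.exp s * ξ) - 1‖ ≤ 1 / 2) :
    ‖2 * (n * Complex.exp (n * s)) * branchFun n a s (1 + Complex.exp s * ξ) - logCoeff n a‖ ≤
      4 * n * ‖a‖ * Real.exp s.re := by
  set E := 1 + Complex.exp s * ξ with hEdef
  rcases hn.eq_or_lt with rfl | hn3
  · have h1 : 2 * (((2 : ℕ) : ℂ) * Complex.exp ((2 : ℕ) * s)) * branchFun 2 a s E -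
        logCoeff 2 a = 4 * a * ((1 - E) * E ^ (-1 : ℂ)) := by
      have h0 := Complex.slitPlane_ne_zero (mem_slitPlane_of_norm_sub_one_le hE)
      have e : Complex.exp (2 * s) * Complex.exp (-2 * s) = 1 := by
        rw [← Complex.exp_add, ← Complex.exp_zero]
        congr 1
        ring
      rw [branchFun, logCoeff]
      norm_num [Complex.cpow_neg_one]
      rw [neg_mul] at e
      field_simp
      linear_combination 4 * a * e
    have h2 := (norm_cpow_le_two hE zero_le_one le_rfl).2
    rw [Complex.ofReal_one] at h2
    rw [h1, norm_mul, norm_mul, norm_mul, norm_sub_rev 1 E]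
    have h3 : ‖E - 1‖ ≤ Real.exp s.re := by
      rw [hEdef, add_sub_cancel_left, norm_mul, Complex.norm_exp]
      exact mul_le_of_le_one_right (Real.exp_pos _).le hξ
    calc ‖(4 : ℂ)‖ * ‖a‖ * (‖E - 1‖ * ‖E ^ (-1 : ℂ)‖) ≤ 4 * ‖a‖ * (Real.exp s.re * 2) := by
          gcongr
          simp
      _ = _ := by push_cast; ring
  · have h1 : logCoeff n a = 0 := by simp [logCoeff, (show n ≠ 2 by omega)]
    have hn' : (3 : ℝ) ≤ n := by exact_mod_cast hn3
    have h2 := (norm_cpow_le_two hE (θ := 2 / n) (by positivity)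
      (by rw [div_le_one (by linarith)]; linarith)).2
    rw [h1, sub_zero, branchFun]
    simp only [norm_mul]
    rw [Complex.norm_exp, Complex.norm_exp]
    have h4 : Real.exp ((n : ℂ) * s).re * Real.exp (-2 * s).re ≤ Real.exp s.re := by
      rw [← Real.exp_add]
      apply Real.exp_le_exp.2
      have h5 : ((n : ℂ) * s).re = n * s.re := by simp
      have h6 : (-2 * s).re = -2 * s.re := by simp
      rw [h5, h6]
      nlinarith
    have h7 : ‖(n : ℂ)‖ = n := by simp
    rw [h7, Complex.norm_ofNat]
    calc _ = 2 * n * ‖a‖ * (Real.exp ((n : ℂ) * s).re * Real.exp (-2 * s).re) *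
          ‖E ^ (-((2 / n : ℝ) : ℂ))‖ := by ring
      _ ≤ 2 * n * ‖a‖ * Real.exp s.re * 2 := by gcongr
      _ = _ := by ring

theorem radicand_majorant_le {C₀ A y w U U' N B : ℝ} (hC₀ : 0 ≤ C₀) (hA : 0 ≤ A) (hy0 : 0 ≤ y)
    (hy1 : y ≤ 1) (hw0 : 0 ≤ w) (hw1 : w ≤ 1) (hw : w ≤ A * y ^ 2) (hU : U ≤ U' + 1)
    (hU' : 0 ≤ U') (hN : 0 ≤ N)
    (hB : N * y ≤ B) :
    C₀ * (w + U * w ^ 2 + N * w ^ 3) ≤ C₀ * A * (2 + U' + A * B) * y ^ 2 := by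
  have hyy : y ^ 2 ≤ y := by nlinarith
  have hB0 : 0 ≤ B := (mul_nonneg hN hy0).trans hB
  have hNw : N * w ≤ A * B := by
    calc N * w ≤ N * (A * y) := by gcongr; exact hw.trans (by gcongr)
      _ = A * (N * y) := by ring
      _ ≤ A * B := by gcongr
  have hw2 : w ^ 2 ≤ w := by nlinarith
  have hw3 : w ^ 3 ≤ w * w := by nlinarith [mul_nonneg hw0 hw0]
  calc C₀ * (w + U * w ^ 2 + N * w ^ 3) ≤ C₀ * (w + (U' + 1) * w + N * w * w) := by
        refine mul_le_mul_of_nonneg_left (add_le_add (add_le_add le_rfl ?_) ?_) hC₀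
        · exact mul_le_mul hU hw2 (by positivity) (by positivity)
        · rw [mul_assoc]
          gcongr
    _ ≤ C₀ * (w + (U' + 1) * w + A * B * w) := by gcongr
    _ = C₀ * (2 + U' + A * B) * w := by ring
    _ ≤ C₀ * (2 + U' + A * B) * (A * y ^ 2) := by
      refine mul_le_mul_of_nonneg_left hw (mul_nonneg hC₀ ?_)
      linarith [mul_nonneg hA hB0]
    _ = _ := by ring

theorem exists_isSmallAt (hn : 2 ≤ n) (hε : d.ε ≠ 0) (a u₀ c : ℂ) :
    ∃ C M : ℝ, M ≤ 0 ∧ ∀ s : ℂ, s.re ≤ M → (n = 2 → ‖s‖ ≤ 2 * Real.exp (-s.re)) →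
      C * Real.exp s.re ≤ 1 / 8 ∧
      ∀ x ∈ Metric.ball ((0 : ℂ), c) 1, d.IsSmallAt a u₀ C s x := by
  obtain ⟨C₀, hC₀, hrad⟩ := d.exists_norm_radicand_sub_one_le
  obtain ⟨ρ, hρ, hQ⟩ := d.exists_QInf_ne_zero hε
  obtain ⟨A, hA⟩ : ∃ A, A = 2 * ‖a⁻¹‖ := ⟨_, rfl⟩
  obtain ⟨K, hK⟩ : ∃ K, K = A * (2 * ‖logCoeff n a‖ + ‖c‖ + 1) := ⟨_, rfl⟩
  obtain ⟨C₁, hC₁⟩ : ∃ C₁, C₁ = C₀ * A * (2 + ‖u₀‖ + K) := ⟨_, rfl⟩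
  obtain ⟨C, hC⟩ : ∃ C, C = C₁ + n * C₁ + 4 * n * ‖a‖ := ⟨_, rfl⟩
  have hA0 : 0 ≤ A := by rw [hA]; positivity
  have hK0 : 0 ≤ K := by rw [hK]; positivity
  have hC₁0 : 0 ≤ C₁ := by rw [hC₁]; positivity
  have hsmall : ∀ B b : ℝ, 0 < b → ∀ᶠ x in atBot, B * Real.exp x < b := fun B b hb => by
    have := Real.tendsto_exp_atBot.const_mul B
    rw [mul_zero] at this
    exact this.eventually_lt_const hb
  obtain ⟨M, hM⟩ := eventually_atBot.1 ((hsmall 1 (1 / 2) (by norm_num)).and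
    ((hsmall A 1 one_pos).and ((hsmall A ρ hρ).and ((hsmall C₁ (1 / 2) (by norm_num)).and
    (hsmall C (1 / 8) (by norm_num))))))
  refine ⟨C, min M 0, min_le_right _ _, fun s hs hs2 => ?_⟩
  obtain ⟨m1, m2, m3, m4, m5⟩ := hM s.re (hs.trans (min_le_left _ _))
  have hs0 : s.re ≤ 0 := hs.trans (min_le_right _ _)
  refine ⟨m5.le, fun x hx => ?_⟩
  set y := Real.exp s.re with hy
  have hy0 : 0 < y := Real.exp_pos _
  have hy1 : y ≤ 1 := Real.exp_le_one_iff.2 hs0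
  obtain ⟨hx1, hx2⟩ : ‖x.1‖ ≤ 1 ∧ ‖x.2 - c‖ ≤ 1 := by
    rw [Metric.mem_ball, dist_eq_norm] at hx
    have e1 := (norm_fst_le _).trans hx.le
    have e2 := (norm_snd_le _).trans hx.le
    simp only [Prod.fst_sub, Prod.snd_sub, sub_zero] at e1 e2
    exact ⟨e1, e2⟩
  have hE : ‖(1 + Complex.exp s * x.1) - 1‖ ≤ 1 / 2 := by
    rw [add_sub_cancel_left, norm_mul, Complex.norm_exp, ← hy]
    calc y * ‖x.1‖ ≤ y * 1 := by gcongr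
      _ ≤ 1 / 2 := by linarith
  have hn' : (2 : ℝ) ≤ n := by exact_mod_cast hn
  have hw : ‖(branchFun n a s (1 + Complex.exp s * x.1))⁻¹‖ ≤ A * y ^ 2 := by
    have h2 := (norm_cpow_le_two hE (θ := 2 / n) (by positivity)
      (by rw [div_le_one (by linarith)]; linarith)).1
    rw [inv_branchFun, norm_mul, norm_mul, Complex.norm_exp]
    have h6 : Real.exp (2 * s).re = y ^ 2 := by
      rw [hy, ← Real.exp_nat_mul]
      simp
    rw [h6]
    calc _ ≤ ‖a⁻¹‖ * y ^ 2 * 2 := by gcongr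
      _ = _ := by rw [hA]; ring
  have hyy : y ^ 2 ≤ y := by nlinarith
  have hw' : ‖(branchFun n a s (1 + Complex.exp s * x.1))⁻¹‖ ≤ A * y :=
    hw.trans (by gcongr)
  have hu : ‖u₀ + Complex.exp (n * s)‖ ≤ ‖u₀‖ + 1 := by
    refine (norm_add_le _ _).trans ?_
    gcongr
    rw [Complex.norm_exp, Real.exp_le_one_iff]
    simpa using mul_nonpos_of_nonneg_of_nonpos (by linarith) hs0
  have hH : ‖logCoeff n a * s + x.2‖ * y ≤ 2 * ‖logCoeff n a‖ + ‖c‖ + 1 := by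
    have h1 : ‖logCoeff n a * s‖ * y ≤ 2 * ‖logCoeff n a‖ := by
      by_cases h : n = 2
      · have h3 : Real.exp (-s.re) * y = 1 := by rw [hy, ← Real.exp_add]; simp
        rw [norm_mul]
        calc ‖logCoeff n a‖ * ‖s‖ * y ≤ ‖logCoeff n a‖ * (2 * Real.exp (-s.re)) * y := by
              gcongr
              exact hs2 h
          _ = 2 * ‖logCoeff n a‖ * (Real.exp (-s.re) * y) := by ring
          _ = _ := by rw [h3, mul_one]
      · simp [logCoeff, h]
    have h2 : ‖x.2‖ ≤ ‖c‖ + 1 := by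
      have := norm_add_le (x.2 - c) c
      rw [sub_add_cancel] at this
      linarith
    calc _ ≤ (‖logCoeff n a * s‖ + ‖x.2‖) * y := by gcongr; exact norm_add_le _ _
      _ ≤ 2 * ‖logCoeff n a‖ + (‖c‖ + 1) * 1 := by
        rw [add_mul]
        gcongr
      _ = _ := by ring
  have hR : ‖d.shiftedRadicand a u₀ s x - 1‖ ≤ C₁ * y ^ 2 := by
    have hw1 : ‖(branchFun n a s (1 + Complex.exp s * x.1))⁻¹‖ ≤ 1 := hw'.trans m2.le
    refine (hrad _ _ _ hw1).trans ?_
    have := radicand_majorant_le hC₀.le hA0 hy0.le hy1 (norm_nonneg _) hw1 hw hu (norm_nonneg _)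
      (norm_nonneg _) hH
    rwa [hC₁, hK]
  have hR2 : ‖d.shiftedRadicand a u₀ s x - 1‖ ≤ 1 / 2 :=
    hR.trans ((mul_le_mul_of_nonneg_left hyy hC₁0).trans m4.le)
  have hS := (sqrt_near_one hR2).2.2.2.trans hR
  have hforce := norm_forcing_le hn a hs0 hx1 hE
  refine ⟨hE, hR2, hS.trans ?_, hQ _ (hw'.trans_lt m3), max_le ?_ (hforce.trans ?_)⟩
  · calc C₁ * y ^ 2 ≤ C₁ * y := by gcongr
      _ ≤ C * y := by
        gcongr
        rw [hC]
        have : 0 ≤ n * C₁ + 4 * n * ‖a‖ := by positivity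
        linarith
  · have h3 : Real.exp (-s).re * y = 1 := by
      rw [hy, ← Real.exp_add]
      simp
    change ‖n * Complex.exp (-s) * (d.shiftedRadicand a u₀ s x ^ (1 / 2 : ℂ) - 1)‖ ≤ _
    rw [norm_mul, norm_mul, Complex.norm_exp, Complex.norm_natCast]
    calc _ ≤ n * Real.exp (-s).re * (C₁ * y ^ 2) := by gcongr
      _ = n * C₁ * y * (Real.exp (-s).re * y) := by ring
      _ = n * C₁ * y := by rw [h3, mul_one]
      _ ≤ C * y := by
        gcongr
        rw [hC]
        have : 0 ≤ C₁ + 4 * n * ‖a‖ := by positivity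
        linarith
  · gcongr
    rw [hC]
    have : 0 ≤ C₁ + n * C₁ := by positivity
    linarith

theorem differentiableAt_branchFun {E : Type*} [NormedAddCommGroup E] [NormedSpace ℂ E] (n : ℕ)
    (a : ℂ) {f g : E → ℂ} {p : E} (hf : DifferentiableAt ℂ f p) (hg : DifferentiableAt ℂ g p)
    (hgp : g p ∈ Complex.slitPlane) : DifferentiableAt ℂ (fun p => branchFun n a (f p) (g p)) p := by
  unfold branchFun
  exact ((differentiableAt_const a).mul (hf.const_mul (-2)).cexp).mul
    (hg.cpow (differentiableAt_const _) hgp)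

theorem differentiableAt_shiftedRHS {a u₀ : ℂ} {C : ℝ} {s : ℂ} {x : ℂ × ℂ} (ha : a ≠ 0)
    (h : d.IsSmallAt a u₀ C s x) :
    DifferentiableAt ℂ (Function.uncurry (d.shiftedRHS a u₀)) (s, x) := by
  have hE := mem_slitPlane_of_norm_sub_one_le h.norm_E_sub_one_le
  have hb : DifferentiableAt ℂ
      (fun p : ℂ × ℂ × ℂ => branchFun n a p.1 (1 + Complex.exp p.1 * p.2.1)) (s, x) :=
    differentiableAt_branchFun n a (by fun_prop) (by fun_prop) hE
  have hb0 : branchFun n a s (1 + Complex.exp s * x.1) ≠ 0 := by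
    simp [branchFun, ha, Complex.cpow_eq_zero_iff, Complex.slitPlane_ne_zero hE]
  have hi := hb.fun_inv hb0
  have hL := (d.differentiable_LInf _).comp _ hi
  have hQ := (d.differentiable_QInf _).comp _ hi
  have hr : DifferentiableAt ℂ
      (fun p : ℂ × ℂ × ℂ => d.shiftedRadicand a u₀ p.1 p.2) (s, x) := by
    unfold shiftedRadicand radicand
    have hu : DifferentiableAt ℂ (fun p : ℂ × ℂ × ℂ =>
        (logCoeff n a * p.1 + p.2.2) * (branchFun n a p.1 (1 + Complex.exp p.1 * p.2.1))⁻¹ ^ 3 -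
          2 * (u₀ + Complex.exp (n * p.1)) *
            (branchFun n a p.1 (1 + Complex.exp p.1 * p.2.1))⁻¹ ^ 2) (s, x) := by
      fun_prop
    simp only [div_eq_mul_inv]
    exact (hL.fun_add (hu.fun_mul hQ)).mul_const _
  have hS := hr.cpow (differentiableAt_const (1 / 2 : ℂ))
    (mem_slitPlane_of_norm_sub_one_le h.norm_radicand_sub_one_le)
  refine DifferentiableAt.prodMk ?_ ?_
  · fun_prop
  · fun_prop

theorem shiftedRHS_add_period (hn : n ≠ 2) (a u₀ s : ℂ) (x : ℂ × ℂ) :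
    d.shiftedRHS a u₀ (s + 2 * Real.pi * Complex.I) x = d.shiftedRHS a u₀ s x := by
  have h1 : ∀ m : ℤ, Complex.exp (m * (s + 2 * Real.pi * Complex.I)) = Complex.exp (m * s) := by
    intro m
    rw [mul_add, Complex.exp_add, Complex.exp_int_mul_two_pi_mul_I, mul_one]
  have e1 := h1 1
  have e2 := h1 (-2)
  have e3 := h1 n
  have e4 := h1 (-1)
  push_cast at e1 e2 e3 e4
  rw [one_mul, one_mul] at e1
  rw [neg_one_mul, neg_one_mul] at e4
  simp only [shiftedRHS, shiftedRadicand, branchFun, logCoeff, hn, if_false, e1, e2, e3, e4,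
    zero_mul]

/-- Solutions with `Z ~ a (u - u₀) ^ (-2 / n)` on a region reaching to `Re s = -∞`; the free
parameter `c` is the constant term of `H`. They are single-valued in `e^s` unless `n = 2`. -/
theorem exists_isBranchSystem (hn : 2 ≤ n) (hε : d.ε ≠ 0) {a : ℂ} (ha : a ≠ 0) (u₀ c : ℂ) :
    ∃ C M : ℝ, M ≤ 0 ∧ ∀ Ω : Set ℂ, IsOpen Ω → LeftInvariant Ω → (∀ s ∈ Ω, s.re ≤ M) →
      (n = 2 → ∀ s ∈ Ω, ‖s‖ ≤ 2 * Real.exp (-s.re)) →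
      ∃ E S H : ℂ → ℂ, d.IsBranchSystem a u₀ Ω E S H ∧
        (∀ s ∈ Ω, ‖E s - 1‖ ≤ C * Real.exp s.re) ∧ (∀ s ∈ Ω, ‖S s - 1‖ ≤ C * Real.exp s.re) ∧
        (∀ s ∈ Ω, ‖H s - logCoeff n a * s - c‖ ≤ C * Real.exp s.re) ∧
        (n ≠ 2 → (∀ s ∈ Ω, s + 2 * Real.pi * Complex.I ∈ Ω) →
          ∀ s ∈ Ω, E (s + 2 * Real.pi * Complex.I) = E s) := by
  obtain ⟨C, M, hM0, hsmall⟩ := d.exists_isSmallAt hn hε a u₀ c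
  refine ⟨max C 1, M, hM0, fun Ω hΩ hl hM hlog => ?_⟩
  have hsm : ∀ s ∈ Ω, ∀ x ∈ Metric.ball ((0 : ℂ), c) 1, d.IsSmallAt a u₀ C s x :=
    fun s hs => (hsmall s (hM s hs) fun h => hlog h s hs).2
  obtain ⟨f, hf, hfb, hfC, hper⟩ := exists_singularODE_solution (k := n + 1) hΩ hl
    (by positivity)
    (fun p hp => (d.differentiableAt_shiftedRHS ha (hsm p.1 hp.1 p.2 hp.2)).differentiableWithinAt)
    (fun s hs x hx => (hsm s hs x hx).norm_RHS_le)
    (fun s hs => (hsmall s (hM s hs) fun h => hlog h s hs).1)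
  have hsf := fun s (hs : s ∈ Ω) => hsm s hs (f s) (hfb s hs)
  have hCle : ∀ s : ℂ, C * Real.exp s.re ≤ max C 1 * Real.exp s.re := fun s => by
    gcongr
    exact le_max_left _ _
  refine ⟨fun s => 1 + Complex.exp s * (f s).1,
    fun s => d.shiftedRadicand a u₀ s (f s) ^ (1 / 2 : ℂ),
    fun s => logCoeff n a * s + (f s).2,
    ⟨fun s hs => (hsf s hs).norm_E_sub_one_le,
      fun s hs => (sqrt_near_one (hsf s hs).norm_radicand_sub_one_le).2.2.1,
      fun s hs => (sqrt_near_one (hsf s hs).norm_radicand_sub_one_le).2.1,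
      fun s hs => ?_, fun s hs => ?_, fun s hs => (hsf s hs).QInf_ne_zero⟩,
    fun s hs => ?_, fun s hs => ((hsf s hs).norm_sqrt_sub_one_le).trans (hCle s),
    fun s hs => ?_, fun hn2 hΩ' s hs => ?_⟩
  · have h1 := (Complex.hasDerivAt_exp s).mul (hf s hs).fst
    refine (h1.const_add 1).congr_deriv ?_
    have e : Complex.exp s * Complex.exp (-s) = 1 := by rw [← Complex.exp_add]; simp
    simp only [shiftedRHS]
    push_cast
    linear_combination (n * (d.shiftedRadicand a u₀ s (f s) ^ (1 / 2 : ℂ) - 1)) * e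
  · have h1 := ((hasDerivAt_id s).const_mul (logCoeff n a)).add (hf s hs).snd
    refine h1.congr_deriv ?_
    simp only [shiftedRHS]
    ring
  · have h1 : ‖(f s).1‖ ≤ 1 := by
      have := hfb s hs
      rw [Metric.mem_ball, dist_eq_norm] at this
      have := (norm_fst_le _).trans this.le
      simpa using this
    rw [add_sub_cancel_left, norm_mul, Complex.norm_exp, mul_comm]
    gcongr
    exact h1.trans (le_max_right _ _)
  · have := (norm_snd_le _).trans (hfC s hs)
    rw [add_sub_cancel_left]
    exact this.trans (hCle s)
  · have h1 := hper (2 * Real.pi * Complex.I)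
      (fun s hs => ⟨hΩ' s hs, d.shiftedRHS_add_period hn2 a u₀ s⟩) s hs
    simp only
    rw [h1, Complex.exp_add, Complex.exp_two_pi_mul_I, mul_one]

end Existence

end QuadricConstants

/-! ### The case `n = 1` -/

/-- An enumeration of a border of one index. -/
def finTwoEquivBorder : Fin 2 ≃ Fin 1 ⊕ Unit where
  toFun := ![Sum.inl 0, Sum.inr ()]
  invFun := Sum.elim (fun _ => 0) fun _ => 1
  left_inv := by decide
  right_inv := by decide

/-- An enumeration of a doubly bordered index. -/
def finThreeEquivBorder : Fin 3 ≃ Unit ⊕ (Fin 1 ⊕ Unit) where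
  toFun := ![Sum.inl (), Sum.inr (Sum.inl 0), Sum.inr (Sum.inr ())]
  invFun := Sum.elim (fun _ => 0) (Sum.elim (fun _ => 1) fun _ => 2)
  left_inv := by decide
  right_inv := by decide

namespace QuadricConstants

section One

variable (d : QuadricConstants 1)

theorem Q_one (hφ : d.φ = 0) : d.Q = fun _ => -(d.ε 0 : ℂ) ^ 2 := by
  funext z
  rw [Q, ← Matrix.det_submatrix_equiv_self finTwoEquivBorder, Matrix.det_fin_two]
  simp [finTwoEquivBorder, border, hφ, sq]

theorem L_one (hφ : d.φ = 0) : d.L = fun z : ℂ =>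
    2 * z ^ 3 - d.X₀ 0 0 * z ^ 2 + 2 * d.β 0 * d.ε 0 * z := by
  funext z
  rw [L, ← Matrix.det_submatrix_equiv_self finThreeEquivBorder, Matrix.det_fin_three]
  simp [finThreeEquivBorder, N, border, X, hφ]
  ring

theorem reducedODE_one (hφ : d.φ = 0) (hε : d.ε 0 ≠ 0) (U : Set ℂ) (Z : ℂ → ℂ) :
    (d.reducedODE 1).IsSolutionOn U Z ↔ DifferentiableOn ℂ Z U ∧ ∀ u ∈ U,
      deriv (deriv Z) u = 1 / (8 * d.ζ) * (6 * Z u ^ 2 - 2 * d.X₀ 0 0 * Z u + 2 * d.β 0 * d.ε 0) +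
        (d.ε 0 : ℂ) ^ 2 / (4 * d.ζ) * u := by
  have hε' : (d.ε 0 : ℂ) ≠ 0 := by exact_mod_cast hε
  have hQ := d.Q_one hφ
  have hL : ∀ z, deriv d.L z = 6 * z ^ 2 - 2 * d.X₀ 0 0 * z + 2 * d.β 0 * d.ε 0 := by
    intro z
    rw [d.L_one hφ]
    have h := ((((hasDerivAt_id z).fun_pow 3).const_mul 2).sub
      (((hasDerivAt_id z).fun_pow 2).const_mul (d.X₀ 0 0 : ℂ))).add
      ((hasDerivAt_id z).const_mul (2 * (d.β 0 : ℂ) * d.ε 0))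
    refine (h.congr_deriv ?_).deriv
    simp
    ring
  have hlog : ∀ z, logDeriv d.Q z = 0 := by
    intro z
    rw [hQ, logDeriv_apply]
    simp
  refine and_congr_right fun _ => forall₂_congr fun u _ => ?_
  simp only [reducedODE, hlog, hL]
  simp only [hQ, Set.mem_ofPred_eq]
  have : -(d.ε 0 : ℂ) ^ 2 ≠ 0 := by simp [hε']
  simp only [ne_eq, this, not_false_eq_true, true_and]
  constructor <;> intro h <;> rw [h] <;> ring

/-- The substitution matches the equation with Painlevé I as soon as its constants satisfy the four
equations that come from comparing coefficients. -/
theorem affineEquiv_painleveI (hφ : d.φ = 0) (hε : d.ε 0 ≠ 0) {a b l v : ℂ} (ha : a ≠ 0)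
    (hl : l ≠ 0) (h2 : l ^ 2 = 8 * d.ζ * a) (hu : a * l ^ 3 * d.ε 0 ^ 2 = 4 * d.ζ)
    (h1 : 6 * b = -(d.X₀ 0 0 : ℂ) * a)
    (h0 : 2 * a ^ 2 * d.β 0 * d.ε 0 * l + v = 6 * b ^ 2 * l) :
    (d.reducedODE 1).AffineEquiv ScalarODE.painleveI a b l v := by
  have hζ : (d.ζ : ℂ) ≠ 0 := by exact_mod_cast d.ζ_ne
  refine ⟨ha, hl, fun U Z hU => ?_⟩
  rw [d.reducedODE_one hφ hε]
  have hd1 : ∀ f : ℂ → ℂ, deriv (fun x => f (l * x + v)) = fun x => l * deriv f (l * x + v) := by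
    intro f
    funext x
    have := deriv_comp_mul_left l (fun y => f (y + v)) x
    rw [this, deriv_comp_add_const, smul_eq_mul]
  have hd2 : deriv (deriv fun x => a * Z (l * x + v) + b) =
      fun x => a * l ^ 2 * deriv (deriv Z) (l * x + v) := by
    have e1 : deriv (fun x => a * Z (l * x + v) + b) = fun x => a * (l * deriv Z (l * x + v)) := by
      funext x
      rw [deriv_add_const, deriv_const_mul_field, hd1]
    rw [e1]
    funext x
    rw [deriv_const_mul_field, deriv_const_mul_field, hd1]
    ring
  have hdiff : DifferentiableOn ℂ Z U ↔ DifferentiableOn ℂ (fun x => a * Z (l * x + v) + b)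
      ((fun x => l * x + v) ⁻¹' U) := by
    constructor
    · intro h
      exact ((h.comp (by fun_prop) (Set.mapsTo_preimage _ _)).const_mul a).add_const b
    · intro h
      have h3 := ((h.comp (t := (fun x => l * x + v) ⁻¹' U) (s := U)
        (f := fun u => (u - v) / l) (by fun_prop) (fun u hu => by
          simpa [mul_div_cancel₀ _ hl] using hu)).sub_const b).const_mul a⁻¹
      refine h3.congr fun u _ => ?_
      simp [mul_div_cancel₀ _ hl, ha]
  rw [ScalarODE.IsSolutionOn, ← hdiff]
  refine and_congr_right fun _ => ?_
  have hsurj : ∀ u, ∃ x, u = l * x + v := fun u => ⟨(u - v) / l, by field_simp; ring⟩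
  have k1 : a * l ^ 2 * (1 / (8 * d.ζ)) = a ^ 2 := by
    rw [h2]
    field_simp
  have k2 : a * l ^ 2 * ((d.ε 0 : ℂ) ^ 2 / (4 * d.ζ)) * l = 1 := by
    field_simp
    linear_combination hu
  have key : ∀ x Z₀ D : ℂ, D = 1 / (8 * d.ζ) *
        (6 * Z₀ ^ 2 - 2 * d.X₀ 0 0 * Z₀ + 2 * d.β 0 * d.ε 0) +
        (d.ε 0 : ℂ) ^ 2 / (4 * d.ζ) * (l * x + v) ↔
      a * l ^ 2 * D = 6 * (a * Z₀ + b) ^ 2 + x := by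
    intro x Z₀ D
    have hR : a * l ^ 2 * (1 / (8 * d.ζ) *
        (6 * Z₀ ^ 2 - 2 * d.X₀ 0 0 * Z₀ + 2 * d.β 0 * d.ε 0) +
        (d.ε 0 : ℂ) ^ 2 / (4 * d.ζ) * (l * x + v)) = 6 * (a * Z₀ + b) ^ 2 + x := by
      apply mul_left_cancel₀ hl
      linear_combination (6 * Z₀ ^ 2 - 2 * d.X₀ 0 0 * Z₀ + 2 * d.β 0 * d.ε 0) * l * k1 +
        (l * x + v) * k2 - 2 * a * Z₀ * l * h1 + h0
    rw [← hR]
    exact (mul_right_inj' (mul_ne_zero ha (pow_ne_zero 2 hl))).symm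
  simp only [hd2, ScalarODE.painleveI, Set.mem_univ, true_and, zero_mul, zero_add, one_mul,
    pow_one, Set.mem_preimage]
  constructor
  · intro h x hx
    exact (key x _ _).1 (h _ hx)
  · intro h u hu
    obtain ⟨x, rfl⟩ := hsurj u
    exact (key x _ _).2 (h x hu)

theorem exists_affineEquiv_painleveI (hφ : d.φ = 0) (hε : d.ε ≠ 0) :
    (∃ a b l v : ℂ, (d.reducedODE 1).AffineEquiv ScalarODE.painleveI a b l v) ∧
      (d.β = 0 → d.X₀ = 0 →
        ∃ a l : ℂ, (d.reducedODE 1).AffineEquiv ScalarODE.painleveI a 0 l 0) := by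
  have hε0 : d.ε 0 ≠ 0 := fun h => hε (by
    funext i
    rw [Subsingleton.elim i 0, h]
    rfl)
  have hε' : (d.ε 0 : ℂ) ≠ 0 := by exact_mod_cast hε0
  have hζ : (d.ζ : ℂ) ≠ 0 := by exact_mod_cast d.ζ_ne
  obtain ⟨l, hl⟩ := IsAlgClosed.exists_pow_nat_eq (32 * (d.ζ : ℂ) ^ 2 / d.ε 0 ^ 2)
    (n := 5) (by norm_num)
  have hl0 : l ≠ 0 := by
    rintro rfl
    rw [zero_pow (by norm_num), eq_comm, div_eq_zero_iff] at hl
    simp [hζ, hε'] at hl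
  rw [eq_div_iff (pow_ne_zero 2 hε')] at hl
  set a := l ^ 2 / (8 * d.ζ) with ha
  have ha0 : a ≠ 0 := by simp [ha, hl0, hζ]
  have h2 : l ^ 2 = 8 * d.ζ * a := by rw [ha]; field_simp
  have hu : a * l ^ 3 * d.ε 0 ^ 2 = 4 * d.ζ := by
    rw [ha]
    field_simp
    linear_combination hl
  refine ⟨⟨a, -(d.X₀ 0 0 : ℂ) * a / 6, l, 6 * (-(d.X₀ 0 0 : ℂ) * a / 6) ^ 2 * l -
      2 * a ^ 2 * d.β 0 * d.ε 0 * l, ?_⟩, fun hβ hX => ⟨a, l, ?_⟩⟩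
  · exact d.affineEquiv_painleveI hφ hε0 ha0 hl0 h2 hu (by ring) (by ring)
  · exact d.affineEquiv_painleveI hφ hε0 ha0 hl0 h2 hu (by simp [hX]) (by simp [hβ])

end One

end QuadricConstants

/-! ### Change of parameter -/

namespace ScalarODE

/-- `W'` with parametrization `p'` is, near `y`, obtained from `W` with parametrization `p` by the
holomorphic change of parameter `q`. -/
structure IsReparam (p W p' W' : ℂ → ℂ) (q : ℂ → ℂ) (y : ℂ) : Prop where
  analyticAt : AnalyticAt ℂ q y
  deriv_ne_zero : deriv q y ≠ 0
  param_eq : ∀ᶠ x in 𝓝 y, p' x = p (q x)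
  fun_eq : ∀ᶠ x in 𝓝 y, W' x = W (q x)

variable {p W p' W' q : ℂ → ℂ} {y : ℂ}

theorem IsReparam.eventually (h : IsReparam p W p' W' q y) :
    ∀ᶠ x in 𝓝 y, IsReparam p W p' W' q x := by
  filter_upwards [h.analyticAt.eventually_analyticAt,
    h.analyticAt.deriv.continuousAt.eventually_ne h.deriv_ne_zero,
    h.param_eq.eventually_nhds, h.fun_eq.eventually_nhds] with x h1 h2 h3 h4
  exact ⟨h1, h2, h3, h4⟩

theorem deriv_of_eventuallyEq_comp {f g : ℂ → ℂ} (hq : DifferentiableAt ℂ q y)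
    (hf : DifferentiableAt ℂ f (q y)) (h : ∀ᶠ x in 𝓝 y, g x = f (q x)) :
    deriv g y = deriv f (q y) * deriv q y := by
  rw [EventuallyEq.deriv_eq (show g =ᶠ[𝓝 y] f ∘ q from h), deriv_comp y hf hq]

/-- The derivative `dW/du` does not depend on the parameter. -/
theorem IsReparam.deriv_div_deriv (h : IsReparam p W p' W' q y)
    (hp : DifferentiableAt ℂ p (q y)) (hW : DifferentiableAt ℂ W (q y)) :
    deriv W' y / deriv p' y = deriv W (q y) / deriv p (q y) := by
  have hq := h.analyticAt.differentiableAt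
  rw [deriv_of_eventuallyEq_comp hq hp h.param_eq, deriv_of_eventuallyEq_comp hq hW h.fun_eq,
    mul_div_mul_right _ _ h.deriv_ne_zero]

theorem IsSolutionAlong.reparam {E : ScalarODE} {Ω Ω' : Set ℂ} (hΩ : IsOpen Ω)
    (h : E.IsSolutionAlong p Ω W)
    (hq : ∀ y ∈ Ω', ∃ q : ℂ → ℂ, q y ∈ Ω ∧ IsReparam p W p' W' q y) :
    E.IsSolutionAlong p' Ω' W' := by
  obtain ⟨hp, hW, hE⟩ := h
  have dp : ∀ s ∈ Ω, DifferentiableAt ℂ p s := fun s hs => hp.differentiableAt (hΩ.mem_nhds hs)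
  have dW : ∀ s ∈ Ω, DifferentiableAt ℂ W s := fun s hs => hW.differentiableAt (hΩ.mem_nhds hs)
  have dcomp : ∀ {f g q : ℂ → ℂ} {y : ℂ}, DifferentiableAt ℂ q y → DifferentiableAt ℂ f (q y) →
      (∀ᶠ x in 𝓝 y, g x = f (q x)) → DifferentiableAt ℂ g y := fun hq hf h =>
    (hf.comp _ hq).congr_of_eventuallyEq h
  refine ⟨fun y hy => ?_, fun y hy => ?_, fun y hy => ?_⟩
  · obtain ⟨q, hqy, hr⟩ := hq y hy
    exact (dcomp hr.analyticAt.differentiableAt (dp _ hqy) hr.param_eq).differentiableWithinAt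
  · obtain ⟨q, hqy, hr⟩ := hq y hy
    exact (dcomp hr.analyticAt.differentiableAt (dW _ hqy) hr.fun_eq).differentiableWithinAt
  · obtain ⟨q, hqy, hr⟩ := hq y hy
    obtain ⟨hp0, hreg, heq⟩ := hE _ hqy
    have hqd := hr.analyticAt.differentiableAt
    have hD : ∀ᶠ x in 𝓝 y, deriv W' x / deriv p' x = (fun s => deriv W s / deriv p s) (q x) := by
      filter_upwards [hr.eventually, hr.analyticAt.continuousAt.preimage_mem_nhds
        (hΩ.mem_nhds hqy)] with x hx hqx
      exact hx.deriv_div_deriv (dp _ hqx) (dW _ hqx)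
    have hDd : DifferentiableAt ℂ (fun s => deriv W s / deriv p s) (q y) :=
      ((hW.deriv hΩ).differentiableAt (hΩ.mem_nhds hqy)).fun_div
        ((hp.deriv hΩ).differentiableAt (hΩ.mem_nhds hqy)) hp0
    have e1 := deriv_of_eventuallyEq_comp hqd (dp _ hqy) hr.param_eq
    have e2 := deriv_of_eventuallyEq_comp hqd hDd hD
    rw [hD.self_of_nhds, e2, e1, mul_div_mul_right _ _ hr.deriv_ne_zero, heq,
      hr.fun_eq.self_of_nhds, hr.param_eq.self_of_nhds]
    exact ⟨mul_ne_zero hp0 hr.deriv_ne_zero, hreg, rfl⟩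

theorem isSolutionAlong_id_iff {E : ScalarODE} {U : Set ℂ} {Z : ℂ → ℂ} :
    E.IsSolutionAlong (fun u => u) U Z ↔ E.IsSolutionOn U Z := by
  have h : DifferentiableOn ℂ (fun u : ℂ => u) U := by fun_prop
  simp [IsSolutionAlong, IsSolutionOn, h]

/-! ### Regions in the logarithmic plane -/

theorem isOpen_logRegion (M : ℝ) : IsOpen (logRegion M) :=
  isOpen_lt (by fun_prop) continuous_const

theorem leftInvariant_logRegion (M : ℝ) : LeftInvariant (logRegion M) := by
  intro s hs r hr
  simp only [logRegion, Set.mem_ofPred_eq, Complex.add_re, Complex.ofReal_re, Complex.add_im,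
    Complex.ofReal_im, add_zero] at hs ⊢
  linarith

theorem convex_logRegion (M : ℝ) : Convex ℝ (logRegion M) := by
  have h : ConvexOn ℝ Set.univ fun s : ℂ => s.re + |s.im| :=
    (Complex.reLm.convexOn convex_univ).add
      ((convexOn_norm convex_univ).comp_linearMap Complex.imLm)
  simpa [logRegion] using h.convex_lt M

theorem re_lt_of_mem_logRegion {M : ℝ} {s : ℂ} (hs : s ∈ logRegion M) : s.re < M := by
  have := abs_nonneg s.im
  simp only [logRegion, Set.mem_ofPred_eq] at hs
  linarith

theorem norm_le_neg_re_of_mem_logRegion {M : ℝ} (hM : M ≤ 0) {s : ℂ} (hs : s ∈ logRegion M) :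
    ‖s‖ ≤ 2 * -s.re := by
  have h1 := re_lt_of_mem_logRegion hs
  have h2 := Complex.norm_le_abs_re_add_abs_im s
  simp only [logRegion, Set.mem_ofPred_eq] at hs
  rw [abs_of_nonpos (by linarith : s.re ≤ 0)] at h2
  linarith

theorem norm_le_exp_of_mem_logRegion {M : ℝ} (hM : M ≤ 0) {s : ℂ} (hs : s ∈ logRegion M) :
    ‖s‖ ≤ 2 * Real.exp (-s.re) := by
  have := norm_le_neg_re_of_mem_logRegion hM hs
  have := Real.add_one_le_exp (-s.re)
  linarith

end ScalarODE

namespace QuadricConstants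

open ScalarODE

section FirstIntegral

variable {n : ℕ} (d : QuadricConstants n)

/-- The function `H = Y + 2 u Z` of a solution `Z` in a parameter `s` of `u = p s`, with `Y`
determined by `det N = 4 ζ (Z')²`. -/
noncomputable def solutionH (p W : ℂ → ℂ) (s : ℂ) : ℂ :=
  (4 * d.ζ * (deriv W s / deriv p s) ^ 2 - d.L (W s)) / d.Q (W s) + 2 * p s * W s

theorem solutionH_reparam {p W p' W' q : ℂ → ℂ} {y : ℂ} (h : IsReparam p W p' W' q y)
    (hp : DifferentiableAt ℂ p (q y)) (hW : DifferentiableAt ℂ W (q y)) :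
    d.solutionH p' W' y = d.solutionH p W (q y) := by
  rw [solutionH, solutionH, h.deriv_div_deriv hp hW, h.param_eq.self_of_nhds,
    h.fun_eq.self_of_nhds]

variable {d} in
theorem IsBranchSystem.solutionH_eq {a u₀ : ℂ} {Ω : Set ℂ} {E S H : ℂ → ℂ}
    (h : d.IsBranchSystem a u₀ Ω E S H) (hn : n ≠ 0) (hφ : d.φ = 0)
    (ha : a ^ n = -16 * d.ζ / (n ^ 2 * (-2) ^ n)) (ha0 : a ≠ 0) {s : ℂ} (hs : s ∈ Ω) :
    d.solutionH (fun s : ℂ => u₀ + Complex.exp (n * s)) (fun s => branchFun n a s (E s)) s =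
      H s := by
  have hQ := d.Q_ne_zero hφ (h.branchFun_ne_zero ha0 hs) (h.QInf_ne_zero s hs)
  rw [solutionH, h.quadric hn hφ ha ha0 hs]
  field_simp
  ring

theorem exists_leading_coeff (hn : n ≠ 0) :
    ∃ a : ℂ, a ≠ 0 ∧ a ^ n = -16 * d.ζ / (n ^ 2 * (-2) ^ n) := by
  obtain ⟨a, ha⟩ := IsAlgClosed.exists_pow_nat_eq (-16 * (d.ζ : ℂ) / (n ^ 2 * (-2) ^ n))
    (Nat.pos_of_ne_zero hn)
  refine ⟨a, ?_, ha⟩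
  rintro rfl
  have hζ : (d.ζ : ℂ) ≠ 0 := by exact_mod_cast d.ζ_ne
  rw [zero_pow hn, eq_comm, div_eq_zero_iff] at ha
  simp [hζ, hn] at ha

end FirstIntegral

/-! ### Algebraic branch points -/

section Algebraic

/-- A branch of the logarithm on a neighbourhood of `t₀`. -/
noncomputable def logBranch (t₀ t : ℂ) : ℂ := Complex.log (t / t₀) + Complex.log t₀

theorem logBranch_self {t₀ : ℂ} (h : t₀ ≠ 0) : logBranch t₀ t₀ = Complex.log t₀ := by
  simp [logBranch, h]

theorem analyticAt_logBranch_and_deriv_ne_zero {t₀ : ℂ} (h : t₀ ≠ 0) :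
    AnalyticAt ℂ (logBranch t₀) t₀ ∧ deriv (logBranch t₀) t₀ ≠ 0 := by
  have hs : t₀ / t₀ ∈ Complex.slitPlane := by simp [h]
  constructor
  · exact ((analyticAt_id.div_const (c := t₀)).clog hs).add analyticAt_const
  · have h1 := (((hasDerivAt_id t₀).div_const t₀).clog hs).add_const (Complex.log t₀)
    have h2 : HasDerivAt (logBranch t₀) (1 / t₀ / (id t₀ / t₀)) t₀ := h1
    rw [h2.deriv]
    simp [h]

theorem exp_logBranch {t₀ t : ℂ} (h : t₀ ≠ 0) (ht : t ≠ 0) : Complex.exp (logBranch t₀ t) = t := by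
  rw [logBranch, Complex.exp_add, Complex.exp_log (div_ne_zero ht h), Complex.exp_log h,
    div_mul_cancel₀ _ h]

/-- A function on a left half-plane with period `2πi` depends on `e^s` only. -/
theorem eq_of_exp_eq {f : ℂ → ℂ} {M : ℝ}
    (hf : ∀ s : ℂ, s.re < M → f (s + 2 * Real.pi * Complex.I) = f s) {s s' : ℂ} (hs : s.re < M)
    (h : Complex.exp s = Complex.exp s') : f s = f s' := by
  have hnat : ∀ (k : ℕ) (z : ℂ), z.re < M → f (z + k * (2 * Real.pi * Complex.I)) = f z := by
    intro k
    induction k with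
    | zero => simp
    | succ k ih =>
      intro z hz
      rw [← ih z hz, ← hf (z + k * (2 * Real.pi * Complex.I)) (by simpa using hz)]
      congr 1
      push_cast
      ring
  obtain ⟨m, hm⟩ := Complex.exp_eq_exp_iff_exists_int.1 h
  have hs' : s'.re < M := by
    rw [hm] at hs
    simpa using hs
  obtain ⟨k, rfl | rfl⟩ := m.eq_nat_or_neg
  · rw [hm]
    exact_mod_cast hnat k s' hs'
  · rw [← hnat k s hs, hm]
    congr 1
    push_cast
    ring

/-- The passage from the logarithmic parameter `s` to the parameter `t = e^s`. -/
theorem isReparam_logBranch {f : ℂ → ℂ} {M : ℝ}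
    (hf : ∀ s : ℂ, s.re < M → f (s + 2 * Real.pi * Complex.I) = f s) (n : ℕ) (u₀ : ℂ) {t₀ : ℂ}
    (ht : t₀ ≠ 0) (htM : ‖t₀‖ < Real.exp M) :
    IsReparam (fun s : ℂ => u₀ + Complex.exp (n * s)) f (fun t => u₀ + t ^ n)
      (fun t => f (Complex.log t)) (logBranch t₀) t₀ := by
  obtain ⟨h1, h2⟩ := analyticAt_logBranch_and_deriv_ne_zero ht
  refine ⟨h1, h2, ?_, ?_⟩
  · filter_upwards [eventually_ne_nhds ht] with t ht'
    rw [Complex.exp_nat_mul, exp_logBranch ht ht']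
  · have h3 : ∀ᶠ t : ℂ in 𝓝 t₀, ‖t‖ < Real.exp M :=
      continuous_norm.continuousAt.eventually_lt_const htM
    filter_upwards [eventually_ne_nhds ht, h3] with t ht' htM'
    refine eq_of_exp_eq hf ?_ ?_
    · rw [Complex.log_re]
      exact (Real.log_lt_iff_lt_exp (norm_pos_iff.2 ht')).2 htM'
    · rw [Complex.exp_log ht', exp_logBranch ht ht']

variable {n : ℕ} (d : QuadricConstants n)

/-- A family of solutions with an algebraic branch point, together with the value at the branch
point of `H`, which recovers the parameter of the family. -/
theorem exists_algebraic_branch (hn : 2 < n) (hφ : d.φ = 0) (hε : d.ε ≠ 0) (u₀ c : ℂ) :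
    ∃ W : ℂ → ℂ, (d.reducedODE 1).IsAlgebraicBranch u₀ (-2) n W ∧
      Tendsto (d.solutionH (fun t => u₀ + t ^ n) W) (𝓝[≠] 0) (𝓝 c) := by
  have hn0 : n ≠ 0 := by omega
  obtain ⟨a, ha0, ha⟩ := d.exists_leading_coeff hn0
  obtain ⟨C, M, -, hex⟩ := d.exists_isBranchSystem hn.le hε ha0 u₀ c
  set Ω : Set ℂ := {s | s.re < M} with hΩdef
  have hΩ : IsOpen Ω := isOpen_lt Complex.continuous_re continuous_const
  obtain ⟨E, S, H, hsys, hE, -, hH, hper⟩ := hex Ω hΩ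
    (fun s hs r hr => by
      simp only [hΩdef, Set.mem_ofPred_eq, Complex.add_re, Complex.ofReal_re] at hs ⊢
      linarith) (fun s hs => le_of_lt hs) (fun h => by omega)
  have hperE := hper (by omega) (fun s hs => by simpa [hΩdef] using hs)
  set f : ℂ → ℂ := fun s => branchFun n a s (E s) with hf
  have hperf : ∀ s : ℂ, s.re < M → f (s + 2 * Real.pi * Complex.I) = f s := by
    intro s hs
    have e : Complex.exp (-2 * (s + 2 * Real.pi * Complex.I)) = Complex.exp (-2 * s) := by
      have := Complex.exp_int_mul_two_pi_mul_I (-2)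
      push_cast at this
      rw [mul_add, Complex.exp_add, this, mul_one]
    simp only [hf, branchFun, hperE s hs, e]
  have hmem : ∀ t : ℂ, t ≠ 0 → ‖t‖ < Real.exp M → Complex.log t ∈ Ω := by
    intro t ht htM
    simp only [hΩdef, Set.mem_ofPred_eq, Complex.log_re]
    exact (Real.log_lt_iff_lt_exp (norm_pos_iff.2 ht)).2 htM
  have hsol := hsys.isSolutionAlong hΩ hn0 hφ ha ha0
  have hnear : ∀ᶠ t : ℂ in 𝓝[≠] 0, t ≠ 0 ∧ ‖t‖ < Real.exp M := by
    refine (eventually_mem_nhdsWithin).and (nhdsWithin_le_nhds ?_)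
    filter_upwards [Metric.ball_mem_nhds (0 : ℂ) (Real.exp_pos M)] with t ht
    simpa using ht
  have hexp : ∀ t : ℂ, t ≠ 0 → Real.exp (Complex.log t).re = ‖t‖ := fun t ht => by
    rw [Complex.log_re, Real.exp_log (norm_pos_iff.2 ht)]
  have hlim : Tendsto (fun t : ℂ => C * ‖t‖) (𝓝[≠] 0) (𝓝 0) := by
    have : Continuous fun t : ℂ => C * ‖t‖ := by fun_prop
    simpa using (this.tendsto 0).mono_left nhdsWithin_le_nhds
  refine ⟨fun t => f (Complex.log t), ⟨by omega, ?_, ⟨Real.exp M, Real.exp_pos M, ?_⟩, a, ha0, ?_⟩,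
    ?_⟩
  · rw [dvd_neg]
    intro h
    have := Int.le_of_dvd (by norm_num) h
    omega
  · refine hsol.reparam hΩ fun t ht => ⟨logBranch t, ?_⟩
    have ht0 : t ≠ 0 := ht.2
    have htM : ‖t‖ < Real.exp M := by simpa using ht.1
    rw [logBranch_self ht0]
    exact ⟨hmem t ht0 htM, isReparam_logBranch hperf n u₀ ht0 htM⟩
  · have hE1 : Tendsto (fun t => E (Complex.log t)) (𝓝[≠] 0) (𝓝 1) := by
      rw [tendsto_iff_norm_sub_tendsto_zero]
      refine squeeze_zero' (Eventually.of_forall fun _ => norm_nonneg _) ?_ hlim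
      filter_upwards [hnear] with t ht
      rw [← hexp t ht.1]
      exact hE _ (hmem t ht.1 ht.2)
    have h1 : Tendsto (fun t => a * E (Complex.log t) ^ (-((2 / n : ℝ) : ℂ))) (𝓝[≠] 0)
        (𝓝 (a * 1 ^ (-((2 / n : ℝ) : ℂ)))) :=
      (hE1.cpow tendsto_const_nhds (by simp)).const_mul a
    rw [Complex.one_cpow, mul_one] at h1
    refine h1.congr' ?_
    filter_upwards [hnear] with t ht
    have e : Complex.exp (-2 * Complex.log t) = t ^ (-2 : ℤ) := by
      have h5 := Complex.exp_int_mul (Complex.log t) (-2)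
      rw [Complex.exp_log ht.1] at h5
      rw [← h5]
      norm_num
    have h6 : t ^ (-2 : ℤ) ≠ 0 := zpow_ne_zero _ ht.1
    simp only [hf, branchFun, e]
    rw [mul_right_comm, mul_div_cancel_right₀ _ h6]
  · have hH1 : Tendsto (fun t => H (Complex.log t)) (𝓝[≠] 0) (𝓝 c) := by
      rw [tendsto_iff_norm_sub_tendsto_zero]
      refine squeeze_zero' (Eventually.of_forall fun _ => norm_nonneg _) ?_ hlim
      filter_upwards [hnear] with t ht
      rw [← hexp t ht.1]
      have := hH _ (hmem t ht.1 ht.2)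
      rwa [logCoeff, if_neg (by omega), zero_mul, sub_zero] at this
    refine hH1.congr' ?_
    filter_upwards [hnear] with t ht
    have hm := hmem t ht.1 ht.2
    have h7 := d.solutionH_reparam (isReparam_logBranch hperf n u₀ ht.1 ht.2)
      (hsol.1.differentiableAt (hΩ.mem_nhds (by rwa [logBranch_self ht.1])))
      (hsol.2.1.differentiableAt (hΩ.mem_nhds (by rwa [logBranch_self ht.1])))
    rw [h7, logBranch_self ht.1]
    exact (hsys.solutionH_eq hn0 hφ ha ha0 hm).symm

theorem exists_algebraic_branch_family (hn : 2 < n) (hφ : d.φ = 0) (hε : d.ε ≠ 0) (u₀ : ℂ) :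
    ∃ W : ℂ → ℂ → ℂ, (∀ c : ℂ, (d.reducedODE 1).IsAlgebraicBranch u₀ (-2) n (W c)) ∧
      ∀ c c' ω : ℂ, ω ^ n = 1 → (∀ᶠ t in 𝓝[≠] (0 : ℂ), W c (ω * t) = W c' t) → c = c' := by
  choose W hW hlim using d.exists_algebraic_branch hn hφ hε u₀
  refine ⟨W, hW, fun c c' ω hω h => ?_⟩
  have hω0 : ω ≠ 0 := by
    rintro rfl
    rw [zero_pow (by omega)] at hω
    exact zero_ne_one hω
  have hmul : Tendsto (fun t => ω * t) (𝓝[≠] (0 : ℂ)) (𝓝[≠] 0) := by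
    refine tendsto_nhdsWithin_iff.2 ⟨?_, ?_⟩
    · have : Continuous fun t : ℂ => ω * t := by fun_prop
      simpa using (this.tendsto 0).mono_left nhdsWithin_le_nhds
    · filter_upwards [eventually_mem_nhdsWithin] with t ht
      exact mul_ne_zero hω0 ht
  obtain ⟨-, -, ⟨δ, hδ, hsol⟩, -⟩ := hW c
  have hopen : IsOpen (Metric.ball (0 : ℂ) δ \ {0}) := Metric.isOpen_ball.sdiff isClosed_singleton
  have hball : ∀ᶠ t in 𝓝[≠] (0 : ℂ), t ∈ Metric.ball (0 : ℂ) δ \ {0} :=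
    Filter.inter_mem (nhdsWithin_le_nhds (Metric.ball_mem_nhds 0 hδ)) eventually_mem_nhdsWithin
  refine tendsto_nhds_unique ((hlim c).comp hmul) ((hlim c').congr' ?_)
  filter_upwards [eventually_eventually_nhdsWithin.2 h, eventually_mem_nhdsWithin,
    hmul.eventually hball] with t ht ht0 htb
  have hr : IsReparam (fun t => u₀ + t ^ n) (W c) (fun t => u₀ + t ^ n) (W c') (fun t => ω * t)
      t := by
    refine ⟨by fun_prop, ?_, Eventually.of_forall fun x => by simp only [mul_pow, hω, one_mul], ?_⟩
    · have : HasDerivAt (fun t => ω * t) ω t := by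
        simpa using (hasDerivAt_id t).const_mul ω
      rw [this.deriv]
      exact hω0
    · have ht' : ∀ᶠ x in 𝓝 t, W c (ω * x) = W c' x := by
        rwa [(isOpen_compl_singleton.nhdsWithin_eq ht0)] at ht
      exact ht'.mono fun x hx => hx.symm
  exact d.solutionH_reparam hr (hsol.1.differentiableAt (hopen.mem_nhds htb))
    (hsol.2.1.differentiableAt (hopen.mem_nhds htb))

end Algebraic

end QuadricConstants

/-! ### Failure of the Painlevé property -/

namespace ScalarODE

/-- If the local solutions extend meromorphically, then a solution around `u₀` that is holomorphic in
`s`, `u = u₀ + e^{ns}`, takes the same values on all sheets. -/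
theorem HasPainleveProperty.eventually_periodic {E : ScalarODE} (hE : E.HasPainleveProperty)
    {n : ℕ} (hn : n ≠ 0) {u₀ : ℂ} {Ω : Set ℂ} (hΩ : IsOpen Ω) (hΩc : IsPreconnected Ω)
    {W : ℂ → ℂ} (hW : E.IsSolutionAlong (fun s : ℂ => u₀ + Complex.exp (n * s)) Ω W)
    {s₁ : ℝ} (hs₁ : (s₁ : ℂ) ∈ Ω) {s : ℂ} (hs : s ∈ Ω)
    (hs' : s + 2 * Real.pi * Complex.I / n ∈ Ω) :
    ∀ᶠ x in 𝓝 s, W (x + 2 * Real.pi * Complex.I / n) = W x := by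
  have hn' : (n : ℂ) ≠ 0 := by exact_mod_cast hn
  set p : ℂ → ℂ := fun s => u₀ + Complex.exp (n * s) with hp
  set q : ℂ → ℂ := fun u => Complex.log (u - u₀) / n with hq
  -- on the strip `|Im s| < π / n` the map `q` inverts the parametrization
  have hqp : ∀ x : ℂ, |n * x.im| < Real.pi → q (p x) = x := by
    intro x hx
    have him : ((n : ℂ) * x).im = n * x.im := by simp
    obtain ⟨h1, h2⟩ := abs_lt.1 hx
    simp only [hq, hp, add_sub_cancel_left]
    rw [Complex.log_exp (by rwa [him]) (by rw [him]; exact h2.le), mul_div_cancel_left₀ _ hn']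
  have hq₁ : q (p s₁) = s₁ := hqp s₁ (by simp [Real.pi_pos])
  have hslit : p s₁ - u₀ ∈ Complex.slitPlane := by
    simp only [hp, add_sub_cancel_left]
    have : Complex.exp (n * (s₁ : ℂ)) = ((Real.exp (n * s₁) : ℝ) : ℂ) := by push_cast; rfl
    rw [this]
    exact Or.inl (Real.exp_pos _)
  have hqan : ∀ u, u - u₀ ∈ Complex.slitPlane →
      AnalyticAt ℂ q u ∧ HasDerivAt q (1 / (u - u₀) / n) u := by
    intro u hu
    constructor
    · exact ((analyticAt_id.sub analyticAt_const).clog hu).div_const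
    · exact (((hasDerivAt_id u).sub_const u₀).clog hu).div_const _
  have hnhds : ∀ᶠ u in 𝓝 (p s₁), u - u₀ ∈ Complex.slitPlane ∧ q u ∈ Ω := by
    refine Filter.inter_mem ((Complex.isOpen_slitPlane.preimage (f := fun u => u - u₀)
      (by fun_prop)).mem_nhds hslit) ?_
    exact (hqan _ hslit).1.continuousAt.preimage_mem_nhds (hΩ.mem_nhds (by rwa [hq₁]))
  obtain ⟨r, hr, hball⟩ := Metric.eventually_nhds_iff_ball.1 hnhds
  have hsol : E.IsSolutionOn (Metric.ball (p s₁) r) (W ∘ q) := by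
    rw [← isSolutionAlong_id_iff]
    refine hW.reparam hΩ fun u hu => ⟨q, (hball u hu).2, (hqan u (hball u hu).1).1, ?_, ?_,
      Eventually.of_forall fun _ => rfl⟩
    · rw [(hqan u (hball u hu).1).2.deriv]
      exact div_ne_zero (one_div_ne_zero (Complex.slitPlane_ne_zero (hball u hu).1)) hn'
    · filter_upwards [Metric.isOpen_ball.mem_nhds hu] with x hx
      have hx0 := Complex.slitPlane_ne_zero (hball x hx).1
      simp only [hq, hp]
      rw [mul_div_cancel₀ _ hn', Complex.exp_log hx0]
      ring
  obtain ⟨f, hf, hfZ⟩ := hE _ r _ hr hsol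
  have hWan : AnalyticOnNhd ℂ W Ω := hW.2.1.analyticOnNhd hΩ
  have hmer : MeromorphicOn (fun x => f (p x) - W x) Ω := fun x hx =>
    ((hf (p x)).comp_analyticAt (by fun_prop)).fun_sub (hWan x hx).meromorphicAt
  have hp_cont : Continuous p := by fun_prop
  have htop₁ : meromorphicOrderAt (fun x => f (p x) - W x) s₁ = ⊤ := by
    rw [meromorphicOrderAt_eq_top_iff]
    refine nhdsWithin_le_nhds ?_
    have him : ∀ᶠ x : ℂ in 𝓝 (s₁ : ℂ), |n * x.im| < Real.pi := by
      have hc : Continuous fun x : ℂ => |(n : ℝ) * x.im| := by fun_prop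
      exact hc.continuousAt.eventually_lt_const (by simp [Real.pi_pos])
    filter_upwards [him, hp_cont.continuousAt.preimage_mem_nhds (Metric.ball_mem_nhds _ hr)]
      with x hx hxb
    rw [hfZ hxb, Function.comp_apply, hqp x hx, sub_self]
  have htop : ∀ x ∈ Ω, ∀ᶠ z in 𝓝[≠] x, f (p z) = W z := by
    intro x hx
    have h1 : meromorphicOrderAt (fun x => f (p x) - W x) x = ⊤ := by
      by_contra hne
      exact hmer.meromorphicOrderAt_ne_top_of_isPreconnected hΩc hx hs₁ hne htop₁
    exact (meromorphicOrderAt_eq_top_iff.1 h1).mono fun z hz => sub_eq_zero.1 hz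
  set ω : ℂ := 2 * Real.pi * Complex.I / n with hω
  have hpω : ∀ x, p (x + ω) = p x := by
    intro x
    simp only [hp, hω]
    rw [mul_add, mul_div_cancel₀ _ hn', Complex.exp_add, Complex.exp_two_pi_mul_I, mul_one]
  have hcont : ContinuousAt (fun x => W (x + ω)) s :=
    ContinuousAt.comp (g := W) (hWan _ hs').continuousAt (by fun_prop)
  refine (hcont.eventuallyEq_nhds_iff_eventuallyEq_nhdsNE (hWan s hs).continuousAt).1 ?_
  have hshift : Tendsto (fun x => x + ω) (𝓝[≠] s) (𝓝[≠] (s + ω)) := by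
    refine tendsto_nhdsWithin_iff.2 ⟨?_, ?_⟩
    · have : Continuous fun x : ℂ => x + ω := by fun_prop
      exact (this.tendsto s).mono_left nhdsWithin_le_nhds
    · filter_upwards [eventually_mem_nhdsWithin] with x hx
      simpa using hx
  filter_upwards [htop s hs, hshift.eventually (htop _ hs')] with x h1 h2
  rw [← h1, ← h2, hpω]

end ScalarODE

namespace QuadricConstants

open ScalarODE

theorem not_hasPainleveProperty {n : ℕ} (d : QuadricConstants n) (hn : 1 < n) (hφ : d.φ = 0)
    (hε : d.ε ≠ 0) : ¬ (d.reducedODE 1).HasPainleveProperty := by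
  intro hP
  have hn0 : n ≠ 0 := by omega
  have hn' : (n : ℂ) ≠ 0 := by exact_mod_cast hn0
  obtain ⟨a, ha0, ha⟩ := d.exists_leading_coeff hn0
  obtain ⟨C, M, hM, hex⟩ := d.exists_isBranchSystem hn hε ha0 0 0
  obtain ⟨E, S, H, hsys, hE, -, hH, -⟩ := hex (logRegion M) (isOpen_logRegion M)
    (leftInvariant_logRegion M) (fun s hs => (re_lt_of_mem_logRegion hs).le)
    (fun _ s hs => norm_le_exp_of_mem_logRegion hM hs)
  have hΩ := isOpen_logRegion M
  have hsol := hsys.isSolutionAlong hΩ hn0 hφ ha ha0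
  set ω : ℂ := 2 * Real.pi * Complex.I / n with hω
  have hωre : ω.re = 0 := by simp [hω, Complex.div_natCast_re]
  have hmem : ∀ᶠ x : ℝ in atBot, (x : ℂ) ∈ logRegion M ∧ (x : ℂ) + ω ∈ logRegion M := by
    filter_upwards [eventually_lt_atBot M, eventually_lt_atBot (M - |ω.im|)] with x h1 h2
    constructor
    · simpa [logRegion] using h1
    · simp only [logRegion, Set.mem_ofPred_eq, Complex.add_re, Complex.ofReal_re, hωre,
        Complex.add_im, Complex.ofReal_im, zero_add, add_zero]
      linarith
  obtain ⟨s₁, hs₁, -⟩ := hmem.exists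
  have hper : ∀ x : ℝ, (x : ℂ) ∈ logRegion M → (x : ℂ) + ω ∈ logRegion M →
      ∀ᶠ z in 𝓝 (x : ℂ), branchFun n a (z + ω) (E (z + ω)) = branchFun n a z (E z) :=
    fun x hx hx' => hP.eventually_periodic hn0 hΩ (convex_logRegion M).isPreconnected hsol hs₁
      hx hx'
  have hlim : Tendsto (fun x : ℝ => C * Real.exp x) atBot (𝓝 0) := by
    simpa using Real.tendsto_exp_atBot.const_mul C
  have hlimω : ∀ {f : ℂ → ℂ} {b : ℂ}, (∀ s ∈ logRegion M, ‖f s - b‖ ≤ C * Real.exp s.re) →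
      Tendsto (fun x : ℝ => f x) atBot (𝓝 b) ∧ Tendsto (fun x : ℝ => f (x + ω)) atBot (𝓝 b) := by
    intro f b hf
    constructor
    · rw [tendsto_iff_norm_sub_tendsto_zero]
      refine squeeze_zero' (Eventually.of_forall fun _ => norm_nonneg _) ?_ hlim
      filter_upwards [hmem] with x hx
      simpa using hf x hx.1
    · rw [tendsto_iff_norm_sub_tendsto_zero]
      refine squeeze_zero' (Eventually.of_forall fun _ => norm_nonneg _) ?_ hlim
      filter_upwards [hmem] with x hx
      simpa [hωre] using hf _ hx.2
  rcases (show 2 ≤ n from hn).eq_or_lt with h2 | h3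
  · -- for `n = 2` the function `H` gains `4 a ω` on the next sheet
    have hHper : ∀ᶠ x : ℝ in atBot, H (x + ω) = H x := by
      filter_upwards [hmem] with x hx
      have hr : IsReparam (fun s : ℂ => (0 : ℂ) + Complex.exp (n * s))
          (fun s => branchFun n a s (E s)) (fun s : ℂ => (0 : ℂ) + Complex.exp (n * s))
          (fun s => branchFun n a s (E s)) (fun z => z + ω) x := by
        refine ⟨by fun_prop, ?_, Eventually.of_forall fun z => ?_,
          (hper x hx.1 hx.2).mono fun z hz => hz.symm⟩
        · rw [deriv_add_const, deriv_id'']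
          exact one_ne_zero
        · rw [mul_add, hω, mul_div_cancel₀ _ hn', Complex.exp_add, Complex.exp_two_pi_mul_I,
            mul_one]
      have := d.solutionH_reparam hr (hsol.1.differentiableAt (hΩ.mem_nhds hx.2))
        (hsol.2.1.differentiableAt (hΩ.mem_nhds hx.2))
      rw [hsys.solutionH_eq hn0 hφ ha ha0 hx.1, hsys.solutionH_eq hn0 hφ ha ha0 hx.2] at this
      exact this.symm
    obtain ⟨l1, l2⟩ := hlimω (f := fun s => H s - logCoeff n a * s) hH
    have l3 := (l2.sub l1).congr' (f₂ := fun _ => -(logCoeff n a * ω)) (by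
      filter_upwards [hHper] with x hx
      rw [hx]
      ring)
    have l4 := tendsto_nhds_unique l3 tendsto_const_nhds
    have hω0 : ω ≠ 0 := by simp [hω, hn0, Real.pi_ne_zero]
    simp [logCoeff, ← h2, ha0, hω0] at l4
  · -- for `n > 2` the leading term changes by the factor `e^{-2ω} ≠ 1`
    obtain ⟨l1, l2⟩ := hlimω hE
    have hc : ∀ {g : ℝ → ℂ}, Tendsto g atBot (𝓝 1) →
        Tendsto (fun x => g x ^ (-((2 / n : ℝ) : ℂ))) atBot (𝓝 1) := by
      intro g hg
      have := hg.cpow (tendsto_const_nhds (x := (-((2 / n : ℝ) : ℂ)))) (by simp)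
      rwa [Complex.one_cpow] at this
    have l3 : Tendsto (fun x : ℝ => Complex.exp (-2 * ω) *
        E (x + ω) ^ (-((2 / n : ℝ) : ℂ))) atBot (𝓝 (Complex.exp (-2 * ω) * 1)) :=
      (hc l2).const_mul _
    have l4 := l3.congr' (f₂ := fun x : ℝ => E x ^ (-((2 / n : ℝ) : ℂ))) (by
      filter_upwards [hmem] with x hx
      have h5 := (hper x hx.1 hx.2).self_of_nhds
      simp only [branchFun] at h5
      rw [mul_add, Complex.exp_add] at h5
      have h6 : a * Complex.exp (-2 * x) ≠ 0 := mul_ne_zero ha0 (Complex.exp_ne_zero _)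
      apply mul_left_cancel₀ h6
      linear_combination h5)
    have l5 := tendsto_nhds_unique l4 (hc l1)
    rw [mul_one, Complex.exp_eq_one_iff] at l5
    obtain ⟨k, hk⟩ := l5
    have hπ : (2 * Real.pi * Complex.I : ℂ) ≠ 0 := by simp [Real.pi_ne_zero]
    have h7 : (k * n : ℂ) = -2 := by
      rw [hω] at hk
      apply mul_right_cancel₀ hπ
      field_simp at hk
      linear_combination (-2 * Real.pi * Complex.I) * hk
    have h8 : k * (n : ℤ) = -2 := by exact_mod_cast h7
    have h9 : (n : ℤ) ∣ 2 := ⟨-k, by linarith⟩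
    have := Int.le_of_dvd (by norm_num) h9
    omega

end QuadricConstants

/-! ### The radicand for `n = 2` -/

/-- An enumeration of a border of two indices. -/
def finThreeEquivBorderTwo : Fin 3 ≃ Fin 2 ⊕ Unit where
  toFun := ![Sum.inl 0, Sum.inl 1, Sum.inr ()]
  invFun := Sum.elim ![0, 1] fun _ => 2
  left_inv := by decide
  right_inv := by decide

/-- An enumeration of a double border of two indices. -/
def finFourEquivBorderTwo : Fin 4 ≃ Unit ⊕ (Fin 2 ⊕ Unit) where
  toFun := ![Sum.inl (), Sum.inr (Sum.inl 0), Sum.inr (Sum.inl 1), Sum.inr (Sum.inr ())]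
  invFun := Sum.elim (fun _ => 0) (Sum.elim ![1, 2] fun _ => 3)
  left_inv := by decide
  right_inv := by decide

namespace QuadricConstants

section Two

variable (d : QuadricConstants 2)

theorem QInf_two (w : ℂ) : d.QInf w = 2 * (d.ε 0 ^ 2 + d.ε 1 ^ 2) -
    w * (d.ε 0 ^ 2 * d.X₀ 1 1 + d.ε 1 ^ 2 * d.X₀ 0 0 - 2 * d.X₀ 0 1 * d.ε 0 * d.ε 1) := by
  have hs : d.X₀ 1 0 = d.X₀ 0 1 := d.symm.apply 0 1
  rw [QInf, ← Matrix.det_submatrix_equiv_self finThreeEquivBorderTwo, Matrix.det_fin_three]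
  simp [finThreeEquivBorderTwo, borderInf, hs]
  ring

theorem LInf_two (w : ℂ) : d.LInf w = -4 + 2 * (d.X₀ 0 0 + d.X₀ 1 1) * w -
    (d.X₀ 0 0 * d.X₀ 1 1 - d.X₀ 0 1 ^ 2) * w ^ 2 +
    2 * w ^ 2 * (-2 * (d.β 0 * d.ε 0 + d.β 1 * d.ε 1) +
      w * (d.β 0 * d.ε 0 * d.X₀ 1 1 + d.β 1 * d.ε 1 * d.X₀ 0 0 -
        d.X₀ 0 1 * (d.β 0 * d.ε 1 + d.β 1 * d.ε 0))) +
    w ^ 4 * (d.β 0 * d.ε 1 - d.β 1 * d.ε 0) ^ 2 := by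
  have hs : d.X₀ 1 0 = d.X₀ 0 1 := d.symm.apply 0 1
  have h : (d.NInf w).submatrix finFourEquivBorderTwo finFourEquivBorderTwo =
      !![0, w * d.β 0, w * d.β 1, 1;
        w * d.β 0, -2 + w * d.X₀ 0 0, w * d.X₀ 0 1, w * d.ε 0;
        w * d.β 1, w * d.X₀ 0 1, -2 + w * d.X₀ 1 1, w * d.ε 1;
        1, w * d.ε 0, w * d.ε 1, 0] := by
    ext i j
    fin_cases i <;> fin_cases j <;> simp [finFourEquivBorderTwo, NInf, hs]
  rw [LInf, ← Matrix.det_submatrix_equiv_self finFourEquivBorderTwo, h, Matrix.det_succ_row_zero]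
  simp [Fin.sum_univ_succ, Matrix.det_succ_row_zero, Fin.succAbove]
  ring

end Two

end QuadricConstants

/-! ### Linear equations with decaying right-hand side -/

section Decay

open MeasureTheory Set

variable {Ω : Set ℂ} {ρ h : ℂ → ℂ}

/-- A bounded solution of `ρ' = h - ρ` decays at least as fast as `h`. -/
theorem norm_le_of_linear_ode (hl : LeftInvariant Ω) (hd : ∀ s ∈ Ω, HasDerivAt ρ (h s - ρ s) s)
    (hc : ContinuousOn h Ω) {B : ℝ} (hB : ∀ s ∈ Ω, ‖ρ s‖ ≤ B) {η : ℝ} {k : ℕ}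
    (hh : ∀ s ∈ Ω, ‖h s‖ ≤ η * ‖Complex.exp s ^ k‖) {s : ℂ} (hs : s ∈ Ω) :
    ‖ρ s‖ ≤ η * ‖Complex.exp s ^ k‖ := by
  have hη : 0 ≤ η := by
    have h1 := (norm_nonneg _).trans (hh s hs)
    exact nonneg_of_mul_nonneg_left h1 (norm_pos_iff.2 (pow_ne_zero _ (Complex.exp_ne_zero _)))
  have hbound : ∀ r : ℝ, r ≤ 0 →
      ‖Complex.exp r * h (s + r)‖ ≤ η * ‖Complex.exp s ^ k‖ * Real.exp r := by
    intro r hr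
    have h1 := hh _ (hl s hs r hr)
    rw [Complex.exp_add, mul_pow, norm_mul] at h1
    have h2 : ‖Complex.exp (r : ℂ)‖ = Real.exp r := by simp [Complex.norm_exp]
    have h3 : ‖Complex.exp (r : ℂ) ^ k‖ ≤ 1 := by
      rw [norm_pow, h2]
      exact pow_le_one₀ (Real.exp_pos _).le (Real.exp_le_one_iff.2 hr)
    rw [norm_mul, h2, mul_comm]
    gcongr
    refine h1.trans ?_
    gcongr
    exact mul_le_of_le_one_right (norm_nonneg _) h3
  have hi : IntegrableOn (fun r : ℝ => η * ‖Complex.exp s ^ k‖ * Real.exp r) (Iic 0) :=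
    (integrableOn_exp_Iic 0).const_mul _
  have hcont : ContinuousOn (fun r : ℝ => Complex.exp r * h (s + r)) (Iic 0) :=
    ContinuousOn.mul (by fun_prop) (hc.comp (by fun_prop) fun r hr => hl s hs r hr)
  have hae : ∀ᵐ r : ℝ ∂(volume.restrict (Iic (0 : ℝ))),
      ‖Complex.exp r * h (s + r)‖ ≤ η * ‖Complex.exp s ^ k‖ * Real.exp r := by
    filter_upwards [ae_restrict_mem measurableSet_Iic] with r hr
    exact hbound r hr
  have hint := integral_Iic_of_hasDerivAt_of_tendsto' (a := 0) (m := 0)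
    (f := fun r : ℝ => Complex.exp r * ρ (s + r))
    (f' := fun r : ℝ => Complex.exp r * h (s + r)) ?_
    (hi.mono' (hcont.aestronglyMeasurable measurableSet_Iic) hae) ?_
  · have h1 := norm_integral_le_of_norm_le hi hae
    rw [hint, integral_const_mul, integral_exp_Iic_zero] at h1
    simpa using h1
  · intro r hr
    have h1 : HasDerivAt (fun r : ℝ => Complex.exp (r : ℂ)) (Complex.exp r) r := by
      simpa using (Complex.ofRealCLM.hasDerivAt (x := r)).cexp
    have h2 : HasDerivAt (fun r : ℝ => s + (r : ℂ)) 1 r := by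
      simpa using (Complex.ofRealCLM.hasDerivAt (x := r)).const_add s
    have h3 := (hd _ (hl s hs r hr)).comp r h2
    exact (h1.mul h3).congr_deriv (by simp only [Function.comp_apply]; ring)
  · refine squeeze_zero_norm' (a := fun r : ℝ => Real.exp r * B) ?_ ?_
    · filter_upwards [eventually_le_atBot 0] with r hr
      rw [norm_mul, Complex.norm_exp, Complex.ofReal_re]
      gcongr
      exact hB _ (hl s hs r hr)
    · simpa using Real.tendsto_exp_atBot.mul_const B

theorem eventually_comap_re_inf_principal {P : ℂ → Prop} :
    (∀ᶠ s in comap Complex.re atBot ⊓ 𝓟 Ω, P s) ↔ ∃ m : ℝ, ∀ s ∈ Ω, s.re ≤ m → P s := by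
  rw [eventually_inf_principal, eventually_comap, eventually_atBot]
  constructor
  · rintro ⟨m, hm⟩
    exact ⟨m, fun s hs hsm => hm s.re hsm s rfl hs⟩
  · rintro ⟨m, hm⟩
    refine ⟨m, fun b hb s hsb hs => hm s hs (hsb ▸ hb)⟩

theorem eventually_norm_le_of_linear_ode (hl : LeftInvariant Ω)
    (hd : ∀ s ∈ Ω, HasDerivAt ρ (h s - ρ s) s)
    (hc : ContinuousOn h Ω) {B : ℝ} (hB : ∀ s ∈ Ω, ‖ρ s‖ ≤ B) {η : ℝ} {k : ℕ}
    (hh : ∀ᶠ s in comap Complex.re atBot ⊓ 𝓟 Ω, ‖h s‖ ≤ η * ‖Complex.exp s ^ k‖) :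
    ∀ᶠ s in comap Complex.re atBot ⊓ 𝓟 Ω, ‖ρ s‖ ≤ η * ‖Complex.exp s ^ k‖ := by
  rw [eventually_comap_re_inf_principal] at hh ⊢
  obtain ⟨m, hm⟩ := hh
  refine ⟨m, fun s hs hsm => norm_le_of_linear_ode (Ω := Ω ∩ {s | s.re ≤ m}) ?_
    (fun s hs => hd s hs.1) (hc.mono inter_subset_left) (fun s hs => hB s hs.1)
    (fun s hs => hm s hs.1 hs.2) ⟨hs, hsm⟩⟩
  intro s hs r hr
  refine ⟨hl s hs.1 r hr, ?_⟩
  have := hs.2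
  simp only [Set.mem_ofPred_eq, Complex.add_re, Complex.ofReal_re] at this ⊢
  linarith

theorem isBigO_of_linear_ode (hl : LeftInvariant Ω) (hd : ∀ s ∈ Ω, HasDerivAt ρ (h s - ρ s) s)
    (hc : ContinuousOn h Ω) {B : ℝ} (hB : ∀ s ∈ Ω, ‖ρ s‖ ≤ B) {k : ℕ}
    (hh : h =O[comap Complex.re atBot ⊓ 𝓟 Ω] fun s => Complex.exp s ^ k) :
    ρ =O[comap Complex.re atBot ⊓ 𝓟 Ω] fun s => Complex.exp s ^ k := by
  obtain ⟨η, hη⟩ := hh.bound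
  exact IsBigO.of_bound η (eventually_norm_le_of_linear_ode hl hd hc hB hη)

theorem isLittleO_of_linear_ode (hl : LeftInvariant Ω) (hd : ∀ s ∈ Ω, HasDerivAt ρ (h s - ρ s) s)
    (hc : ContinuousOn h Ω) {B : ℝ} (hB : ∀ s ∈ Ω, ‖ρ s‖ ≤ B) {k : ℕ}
    (hh : h =o[comap Complex.re atBot ⊓ 𝓟 Ω] fun s => Complex.exp s ^ k) :
    ρ =o[comap Complex.re atBot ⊓ 𝓟 Ω] fun s => Complex.exp s ^ k :=
  IsLittleO.of_bound fun _ hη => eventually_norm_le_of_linear_ode hl hd hc hB (hh.bound hη)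

/-- If the forcing is a small multiple of the solution up to `o(e^{3s})`, then the solution itself is
`o(e^{3s})`: each use of the equation gains a factor `e^s`. -/
theorem isLittleO_exp_pow_three_of_linear_ode (hl : LeftInvariant Ω)
    (hd : ∀ s ∈ Ω, HasDerivAt ρ (h s - ρ s) s) (hc : ContinuousOn h Ω) {B : ℝ}
    (hB : ∀ s ∈ Ω, ‖ρ s‖ ≤ B) {A δ : ℂ → ℂ}
    (hA : A =O[comap Complex.re atBot ⊓ 𝓟 Ω] fun _ => (1 : ℂ))
    (hδ : δ =o[comap Complex.re atBot ⊓ 𝓟 Ω] fun s => Complex.exp s ^ 3)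
    (hh : h =ᶠ[comap Complex.re atBot ⊓ 𝓟 Ω] fun s => Complex.exp s * ρ s * A s + δ s) :
    ρ =o[comap Complex.re atBot ⊓ 𝓟 Ω] fun s => Complex.exp s ^ 3 := by
  set 𝓛 := comap Complex.re atBot ⊓ 𝓟 Ω with h𝓛
  have hexp : Tendsto (fun s : ℂ => Complex.exp s) 𝓛 (𝓝 0) := by
    rw [tendsto_zero_iff_norm_tendsto_zero]
    simp only [Complex.norm_exp]
    exact Real.tendsto_exp_atBot.comp (tendsto_comap.mono_left inf_le_left)
  have hexp1 : (fun s : ℂ => Complex.exp s) =O[𝓛] fun _ => (1 : ℂ) := hexp.isBigO_one ℂ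
  have hstep : ∀ j : ℕ, ρ =O[𝓛] (fun s => Complex.exp s ^ j) →
      (fun s => Complex.exp s * ρ s * A s) =O[𝓛] fun s => Complex.exp s ^ (j + 1) := by
    intro j hj
    have := (((isBigO_refl (fun s : ℂ => Complex.exp s) 𝓛).mul hj).mul hA)
    simpa [pow_succ'] using this
  have hle : ∀ j : ℕ, j ≤ 3 → (fun s : ℂ => Complex.exp s ^ 3) =O[𝓛]
      fun s => Complex.exp s ^ j := by
    intro j hj
    have := (isBigO_refl (fun s : ℂ => Complex.exp s ^ j) 𝓛).mul (hexp1.pow (3 - j))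
    simpa [← pow_add, Nat.add_sub_cancel' hj] using this
  have hup : ∀ j : ℕ, j + 1 ≤ 3 → ρ =O[𝓛] (fun s => Complex.exp s ^ j) →
      ρ =O[𝓛] fun s => Complex.exp s ^ (j + 1) := fun j hj hρ =>
    isBigO_of_linear_ode hl hd hc hB
      (hh.trans_isBigO ((hstep j hρ).add (hδ.isBigO.trans (hle (j + 1) hj))))
  have h0 : ρ =O[𝓛] fun s => Complex.exp s ^ 0 := by
    refine IsBigO.of_bound B ?_
    filter_upwards [mem_inf_of_right (mem_principal_self Ω)] with s hs
    simpa using hB s hs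
  have h3 := hup 2 le_rfl (hup 1 (by norm_num) (hup 0 (by norm_num) h0))
  refine isLittleO_of_linear_ode hl hd hc hB (hh.trans_isLittleO (IsLittleO.add ?_ hδ))
  refine (hstep 3 h3).trans_isLittleO ?_
  have := (isBigO_refl (fun s : ℂ => Complex.exp s ^ 3) 𝓛).mul_isLittleO
    ((isLittleO_one_iff ℂ).2 hexp)
  simpa [pow_succ] using this

end Decay

/-! ### Expansion near a logarithmic branch point -/

section Expansion

/-- Truncated expansion of `E` for `n = 2`, with `τ = u - u₀` and `x = τ ln τ`. -/
def truncE (e₁ e₂ e₃ f τ x : ℂ) : ℂ := 1 + e₁ * τ + e₂ * τ ^ 2 + e₃ * τ ^ 3 + f * x * τ ^ 2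

/-- The image of `truncE` under `E ↦ E + τ dE/dτ`. -/
def truncS (e₁ e₂ e₃ f τ x : ℂ) : ℂ :=
  1 + 2 * e₁ * τ + 3 * e₂ * τ ^ 2 + (4 * e₃ + f) * τ ^ 3 + 4 * f * x * τ ^ 2

/-- The radicand agrees with the square of `truncS` to third order. -/
theorem radicand_sub_truncS_sq (e₁ e₂ e₃ f κ k j c : ℂ) :
    ∃ A Φ : ℂ × ℂ × ℂ × ℂ → ℂ, Continuous A ∧ Continuous Φ ∧ Φ 0 = 0 ∧ ∀ τ σ g ρ y : ℂ,
      y = τ * (truncE e₁ e₂ e₃ f τ (τ * σ) + ρ) →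
      1 + 4 * e₁ * y + (6 * e₂ - 8 * f * τ) * y ^ 2 +
          (-4 * e₁ * e₂ + 8 * e₃ + 10 * f + 8 * f * σ + 4 * f * g / κ - k * τ) * y ^ 3 +
          ((2 * κ * σ + c + g) * k / (2 * κ) - j) * y ^ 4 - truncS e₁ e₂ e₃ f τ (τ * σ) ^ 2 =
        τ * ρ * A (τ, τ * σ, g, ρ) + τ ^ 3 * Φ (τ, τ * σ, g, ρ) := by
  -- `c₃`, `c₄` are `τ` times the coefficients of `y ^ 3`, `y ^ 4`; `F` is `τ` times the third order
  -- coefficient of `truncE`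
  let c₃ : ℂ × ℂ × ℂ × ℂ → ℂ := fun p =>
    (-4 * e₁ * e₂ + 8 * e₃ + 10 * f) * p.1 + 8 * f * p.2.1 + 4 * f * p.2.2.1 * p.1 / κ - k * p.1 ^ 2
  let c₄ : ℂ × ℂ × ℂ × ℂ → ℂ := fun p =>
    (2 * κ * p.2.1 + c * p.1 + p.2.2.1 * p.1) * k / (2 * κ) - j * p.1
  let F : ℂ × ℂ × ℂ × ℂ → ℂ := fun p => e₃ * p.1 + f * p.2.1
  let T : ℂ × ℂ × ℂ × ℂ → ℂ := fun p => 1 + e₁ * p.1 + p.1 ^ 2 * (e₂ + F p)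
  let P₂ : ℂ × ℂ × ℂ × ℂ → ℂ := fun p =>
    e₁ ^ 2 + 2 * (e₂ + F p) + 2 * e₁ * p.1 * (e₂ + F p) + p.1 ^ 2 * (e₂ + F p) ^ 2
  let G : ℂ × ℂ × ℂ × ℂ → ℂ := fun p => 4 * F p + f * p.1
  refine ⟨fun p => 4 * e₁ + (6 * e₂ - 8 * f * p.1) * p.1 * (2 * T p + p.2.2.2) +
      c₃ p * p.1 * ((T p + p.2.2.2) ^ 2 + (T p + p.2.2.2) * T p + T p ^ 2) +
      c₄ p * p.1 ^ 2 * (2 * T p + p.2.2.2) * ((T p + p.2.2.2) ^ 2 + T p ^ 2),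
    fun p => 4 * f * p.2.2.1 / κ + 4 * e₁ * F p + p.1 * (6 * e₂ * P₂ p - 16 * e₁ * f) -
      8 * f * p.1 ^ 2 * P₂ p + c₃ p * ((e₁ + p.1 * (e₂ + F p)) * (1 + T p + T p ^ 2)) - k * p.1 +
      c₄ p * T p ^ 4 - (p.1 * 9 * e₂ ^ 2 + 4 * e₁ * G p + 6 * e₂ * p.1 * G p + p.1 * G p ^ 2),
    by fun_prop, by fun_prop, ?_, ?_⟩
  · simp [c₃, c₄, F, G]
  · intro τ σ g ρ y hy
    subst hy
    simp only [truncE, truncS, c₃, c₄, F, G, T, P₂, div_eq_mul_inv]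
    ring

theorem inv_truncE_expansion (e₁ e₂ e₃ f : ℂ) :
    ∃ Ψ : ℂ × ℂ → ℂ, Continuous Ψ ∧ Ψ 0 = 0 ∧ ∀ τ σ : ℂ,
      1 - (1 - e₁ * τ + (e₁ ^ 2 - e₂) * τ ^ 2 +
        (-e₁ ^ 3 + 2 * e₁ * e₂ - e₃ - f * σ) * τ ^ 3) * truncE e₁ e₂ e₃ f τ (τ * σ) =
        τ ^ 3 * Ψ (τ, τ * σ) := by
  let F : ℂ × ℂ → ℂ := fun p => e₃ * p.1 + f * p.2
  let A : ℂ × ℂ → ℂ := fun p => (-e₁ ^ 3 + 2 * e₁ * e₂) * p.1 - F p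
  refine ⟨fun p => -(-e₁ * F p + (e₁ ^ 2 - e₂) * e₂ * p.1 + A p * e₁ +
    p.1 * ((e₁ ^ 2 - e₂) * F p + A p * e₂) + p.1 * A p * F p), by fun_prop, ?_, ?_⟩
  · simp [A, F]
  · intro τ σ
    simp only [truncE, A, F]
    ring

end Expansion

/-! ### Logarithmic branch points -/

namespace QuadricConstants

open ScalarODE

section Logarithmic

variable (d : QuadricConstants 2)

/-- The radicand in terms of the coefficients `e₁`, `e₂`, `e₃`, `f` of the expansion of `E`; here
`y = κ / Z`, `u = u₀ + τ` and `H = 2 κ σ + c + g`. -/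
theorem radicand_two {κ e₁ e₂ e₃ f k j c u₀ : ℂ} (hκ : κ ≠ 0)
    (h₁ : (d.X₀ 0 0 : ℂ) + d.X₀ 1 1 = -8 * κ * e₁)
    (h₂ : ((d.X₀ 0 0 : ℂ) * d.X₀ 1 1 - d.X₀ 0 1 ^ 2) / 4 + (d.β 0 * d.ε 0 + d.β 1 * d.ε 1) +
      u₀ * (d.ε 0 ^ 2 + d.ε 1 ^ 2) = 6 * κ ^ 2 * e₂)
    (hf : (d.ε 0 : ℂ) ^ 2 + d.ε 1 ^ 2 = -8 * κ ^ 2 * f)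
    (hk : (d.ε 0 : ℂ) ^ 2 * d.X₀ 1 1 + d.ε 1 ^ 2 * d.X₀ 0 0 - 2 * d.X₀ 0 1 * d.ε 0 * d.ε 1 =
      2 * κ ^ 3 * k)
    (hj : ((d.β 0 : ℂ) * d.ε 1 - d.β 1 * d.ε 0) ^ 2 = 4 * κ ^ 4 * j)
    (h₃ : (d.β 0 : ℂ) * d.ε 0 * d.X₀ 1 1 + d.β 1 * d.ε 1 * d.X₀ 0 0 -
        d.X₀ 0 1 * (d.β 0 * d.ε 1 + d.β 1 * d.ε 0) + c * (d.ε 0 ^ 2 + d.ε 1 ^ 2) +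
        u₀ * (2 * κ ^ 3 * k) = 2 * κ ^ 3 * (4 * e₁ * e₂ - 8 * e₃ - 10 * f))
    (τ σ g y : ℂ) :
    d.radicand (u₀ + τ) (2 * κ * σ + c + g) (y / κ) =
      1 + 4 * e₁ * y + (6 * e₂ - 8 * f * τ) * y ^ 2 +
        (-4 * e₁ * e₂ + 8 * e₃ + 10 * f + 8 * f * σ + 4 * f * g / κ - k * τ) * y ^ 3 +
        ((2 * κ * σ + c + g) * k / (2 * κ) - j) * y ^ 4 := by
  obtain ⟨w, rfl⟩ : ∃ w, y = κ * w := ⟨y / κ, by field_simp⟩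
  have hg : 4 * f * g / κ * (κ * w) ^ 3 = 4 * f * g * κ ^ 2 * w ^ 3 := by field_simp
  have hH : (2 * κ * σ + c + g) * k / (2 * κ) * (κ * w) ^ 4 =
      (2 * κ * σ + c + g) * k * κ ^ 3 / 2 * w ^ 4 := by field_simp
  rw [mul_div_cancel_left₀ _ hκ, radicand, LInf_two, QInf_two, hk]
  linear_combination (-w / 2) * h₁ + w ^ 2 * h₂ + τ * w ^ 2 * hf -
    w ^ 3 / 2 * (h₃ + (2 * κ * σ + g) * hf) - w ^ 4 / 4 * hj - hg - hH

theorem branchFun_two (κ s E : ℂ) :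
    branchFun 2 κ (s / 2) E = κ * (Complex.exp s * E)⁻¹ := by
  rw [branchFun, mul_inv, ← Complex.exp_neg, mul_assoc]
  norm_num [Complex.cpow_neg_one]
  left
  left
  ring_nf

end Logarithmic

end QuadricConstants

namespace ScalarODE

section Asymptotics

variable {M : ℝ}

/-- The filter of `Re s → -∞` within a region of the logarithmic plane. -/
def logFilter (M : ℝ) : Filter ℂ := comap Complex.re atBot ⊓ 𝓟 (logRegion M)

theorem eventually_mem_logFilter (M : ℝ) : ∀ᶠ s in logFilter M, s ∈ logRegion M :=
  mem_inf_of_right (mem_principal_self _)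

theorem tendsto_re_logFilter (M : ℝ) : Tendsto Complex.re (logFilter M) atBot :=
  tendsto_comap.mono_left inf_le_left

theorem tendsto_exp_logFilter (M : ℝ) : Tendsto (fun s : ℂ => Complex.exp s) (logFilter M) (𝓝 0) := by
  rw [tendsto_zero_iff_norm_tendsto_zero]
  simp only [Complex.norm_exp]
  exact Real.tendsto_exp_atBot.comp (tendsto_re_logFilter M)

theorem tendsto_exp_mul_self_logFilter (hM : M ≤ 0) :
    Tendsto (fun s : ℂ => Complex.exp s * s) (logFilter M) (𝓝 0) := by
  have h1 : Tendsto (fun x : ℝ => 2 * ((-x) ^ 1 * Real.exp (-(-x)))) atBot (𝓝 0) := by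
    simpa using ((Real.tendsto_pow_mul_exp_neg_atTop_nhds_zero 1).comp
      tendsto_neg_atBot_atTop).const_mul 2
  refine squeeze_zero_norm' ?_ (h1.comp (tendsto_re_logFilter M))
  filter_upwards [eventually_mem_logFilter M] with s hs
  rw [norm_mul, Complex.norm_exp, Function.comp_apply, pow_one, neg_neg]
  calc _ ≤ Real.exp s.re * (2 * -s.re) := by
        gcongr
        exact norm_le_neg_re_of_mem_logRegion hM hs
    _ = _ := by ring

theorem tendsto_of_norm_sub_le_logFilter {φ : ℂ → ℂ} {b : ℂ} {C : ℝ}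
    (h : ∀ s ∈ logRegion M, ‖φ s - b‖ ≤ C * Real.exp (s.re / 2)) :
    Tendsto φ (logFilter M) (𝓝 b) := by
  rw [tendsto_iff_norm_sub_tendsto_zero]
  have h1 : Tendsto (fun x : ℝ => C * Real.exp (x / 2)) atBot (𝓝 0) := by
    simpa using (Real.tendsto_exp_atBot.comp (tendsto_id.atBot_div_const two_pos)).const_mul C
  refine squeeze_zero' (Eventually.of_forall fun _ => norm_nonneg _) ?_
    (h1.comp (tendsto_re_logFilter M))
  filter_upwards [eventually_mem_logFilter M] with s hs
  exact h s hs

theorem norm_exp_le_one_of_mem_logRegion (hM : M ≤ 0) {s : ℂ} (hs : s ∈ logRegion M) :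
    ‖Complex.exp s‖ ≤ 1 ∧ ‖Complex.exp s * s‖ ≤ 2 := by
  have h1 := re_lt_of_mem_logRegion hs
  have h2 := norm_le_exp_of_mem_logRegion hM hs
  rw [norm_mul, Complex.norm_exp]
  refine ⟨Real.exp_le_one_iff.2 (by linarith), ?_⟩
  calc _ ≤ Real.exp s.re * (2 * Real.exp (-s.re)) := by gcongr
    _ = 2 * (Real.exp s.re * Real.exp (-s.re)) := by ring
    _ = 2 := by rw [← Real.exp_add]; simp

theorem hasDerivAt_truncE (e₁ e₂ e₃ f s : ℂ) :
    HasDerivAt (fun s => truncE e₁ e₂ e₃ f (Complex.exp s) (Complex.exp s * s))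
      (truncS e₁ e₂ e₃ f (Complex.exp s) (Complex.exp s * s) -
        truncE e₁ e₂ e₃ f (Complex.exp s) (Complex.exp s * s)) s := by
  have h := Complex.hasDerivAt_exp s
  have hx := h.mul (hasDerivAt_id s)
  have := ((((h.const_mul e₁).const_add 1).add ((h.fun_pow 2).const_mul e₂)).add
    ((h.fun_pow 3).const_mul e₃)).add ((hx.const_mul f).mul (h.fun_pow 2))
  refine this.congr_deriv ?_
  simp only [truncE, truncS, Pi.mul_apply, id]
  ring

theorem tendsto_comp_exp_logFilter (hM : M ≤ 0) {p : ℂ × ℂ → ℂ} (hp : Continuous p) :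
    Tendsto (fun s : ℂ => p (Complex.exp s, Complex.exp s * s)) (logFilter M) (𝓝 (p (0, 0))) :=
  (hp.tendsto (0, 0)).comp
    ((tendsto_exp_logFilter M).prodMk_nhds (tendsto_exp_mul_self_logFilter hM))

theorem tendsto_truncE_logFilter (hM : M ≤ 0) (e₁ e₂ e₃ f : ℂ) :
    Tendsto (fun s => truncE e₁ e₂ e₃ f (Complex.exp s) (Complex.exp s * s)) (logFilter M)
      (𝓝 1) := by
  have h := tendsto_comp_exp_logFilter hM (p := fun p => truncE e₁ e₂ e₃ f p.1 p.2)
    (by unfold truncE; fun_prop)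
  have e : truncE e₁ e₂ e₃ f 0 0 = 1 := by simp [truncE]
  dsimp only at h
  rwa [e] at h

theorem tendsto_truncS_logFilter (hM : M ≤ 0) (e₁ e₂ e₃ f : ℂ) :
    Tendsto (fun s => truncS e₁ e₂ e₃ f (Complex.exp s) (Complex.exp s * s)) (logFilter M)
      (𝓝 1) := by
  have h := tendsto_comp_exp_logFilter hM (p := fun p => truncS e₁ e₂ e₃ f p.1 p.2)
    (by unfold truncS; fun_prop)
  have e : truncS e₁ e₂ e₃ f 0 0 = 1 := by simp [truncS]
  dsimp only at h
  rwa [e] at h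

/-- The function `E` agrees with its truncated expansion to third order: the difference satisfies a
linear equation whose forcing is controlled by `radicand_sub_truncS_sq`. -/
theorem isLittleO_sub_truncE (hM : M ≤ 0) {E S g : ℂ → ℂ} {κ e₁ e₂ e₃ f k j c : ℂ}
    (hd : ∀ s ∈ logRegion M, HasDerivAt E (S s - E s) s)
    (hEB : ∀ s ∈ logRegion M, ‖E s - 1‖ ≤ 1 / 2)
    (hS : ∀ s ∈ logRegion M, ∀ y, y = Complex.exp s * E s → S s ^ 2 =
      1 + 4 * e₁ * y + (6 * e₂ - 8 * f * Complex.exp s) * y ^ 2 +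
        (-4 * e₁ * e₂ + 8 * e₃ + 10 * f + 8 * f * s + 4 * f * g s / κ -
          k * Complex.exp s) * y ^ 3 +
        ((2 * κ * s + c + g s) * k / (2 * κ) - j) * y ^ 4)
    (hE1 : Tendsto E (logFilter M) (𝓝 1)) (hS1 : Tendsto S (logFilter M) (𝓝 1))
    (hg0 : Tendsto g (logFilter M) (𝓝 0)) :
    (fun s => E s - truncE e₁ e₂ e₃ f (Complex.exp s) (Complex.exp s * s)) =o[logFilter M]
      fun s => Complex.exp s ^ 3 := by
  obtain ⟨A, Φ, hA, hΦ, hΦ0, hid⟩ := radicand_sub_truncS_sq e₁ e₂ e₃ f κ k j c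
  set T : ℂ → ℂ := fun s => truncE e₁ e₂ e₃ f (Complex.exp s) (Complex.exp s * s) with hT
  set V : ℂ → ℂ := fun s => truncS e₁ e₂ e₃ f (Complex.exp s) (Complex.exp s * s) with hV
  have hT1 : Tendsto T (logFilter M) (𝓝 1) := tendsto_truncE_logFilter hM e₁ e₂ e₃ f
  have hV1 : Tendsto V (logFilter M) (𝓝 1) := tendsto_truncS_logFilter hM e₁ e₂ e₃ f
  have hρ0 : Tendsto (fun s => E s - T s) (logFilter M) (𝓝 0) := by
    simpa using hE1.sub hT1
  have hq : Tendsto (fun s => (Complex.exp s, Complex.exp s * s, g s, E s - T s)) (logFilter M)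
      (𝓝 0) :=
    (tendsto_exp_logFilter M).prodMk_nhds ((tendsto_exp_mul_self_logFilter hM).prodMk_nhds
      (hg0.prodMk_nhds hρ0))
  have hsum : Tendsto (fun s => S s + V s) (logFilter M) (𝓝 (1 + 1)) := hS1.add hV1
  have hinv := hsum.inv₀ (by norm_num)
  have hne := hsum.eventually_ne (show (1 + 1 : ℂ) ≠ 0 by norm_num)
  have hdρ : ∀ s ∈ logRegion M,
      HasDerivAt (fun s => E s - T s) ((S s - V s) - (E s - T s)) s := fun s hs =>
    ((hd s hs).sub (hasDerivAt_truncE e₁ e₂ e₃ f s)).congr_deriv (by simp only [hV, hT]; ring)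
  have hdiff : DifferentiableOn ℂ (fun s => E s - T s) (logRegion M) := fun s hs =>
    (hdρ s hs).differentiableAt.differentiableWithinAt
  refine isLittleO_exp_pow_three_of_linear_ode (leftInvariant_logRegion M) hdρ (h := fun s => S s - V s)
    (B := 1 / 2 + (‖e₁‖ + ‖e₂‖ + ‖e₃‖ + ‖f‖ * 2))
    (A := fun s => A (Complex.exp s, Complex.exp s * s, g s, E s - T s) * (S s + V s)⁻¹)
    (δ := fun s => Complex.exp s ^ 3 *
      (Φ (Complex.exp s, Complex.exp s * s, g s, E s - T s) * (S s + V s)⁻¹)) ?_ ?_ ?_ ?_ ?_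
  · have := ((hdiff.deriv (isOpen_logRegion M)).add hdiff).continuousOn
    refine this.congr fun s hs => ?_
    simp only [Pi.add_apply, (hdρ s hs).deriv]
    ring
  · intro s hs
    obtain ⟨h1, h2⟩ := norm_exp_le_one_of_mem_logRegion hM hs
    have h3 : ∀ m : ℕ, ‖Complex.exp s‖ ^ m ≤ 1 := fun m => pow_le_one₀ (norm_nonneg _) h1
    have e : E s - T s = (E s - 1) - (e₁ * Complex.exp s + e₂ * Complex.exp s ^ 2 +
        e₃ * Complex.exp s ^ 3 + f * (Complex.exp s * s) * Complex.exp s ^ 2) := by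
      simp only [hT, truncE]
      ring
    rw [e]
    refine (norm_sub_le _ _).trans (add_le_add (hEB s hs) ?_)
    refine (norm_add_le _ _).trans (add_le_add ((norm_add_le _ _).trans (add_le_add
      ((norm_add_le _ _).trans (add_le_add ?_ ?_)) ?_)) ?_)
    · rw [norm_mul]
      exact mul_le_of_le_one_right (norm_nonneg _) h1
    · rw [norm_mul, norm_pow]
      exact mul_le_of_le_one_right (norm_nonneg _) (h3 2)
    · rw [norm_mul, norm_pow]
      exact mul_le_of_le_one_right (norm_nonneg _) (h3 3)
    · rw [norm_mul, norm_pow, norm_mul f]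
      calc _ ≤ ‖f‖ * 2 * 1 := by
            gcongr
            exact h3 2
        _ = _ := mul_one _
  · exact (((hA.tendsto 0).comp hq).mul hinv).isBigO_one ℂ
  · have h0 : Tendsto (fun s => Φ (Complex.exp s, Complex.exp s * s, g s, E s - T s) *
        (S s + V s)⁻¹) (logFilter M) (𝓝 0) := by
      have := ((hΦ.tendsto 0).comp hq).mul hinv
      simpa [hΦ0] using this
    have := (isBigO_refl (fun s : ℂ => Complex.exp s ^ 3) (logFilter M)).mul_isLittleO
      ((isLittleO_one_iff ℂ).2 h0)
    simp only [mul_one] at this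
    exact this
  · change ∀ᶠ s in logFilter M, _ = _
    filter_upwards [eventually_mem_logFilter M, hne] with s hs hs0
    have h1 := hid (Complex.exp s) s (g s) (E s - T s) (Complex.exp s * E s) (by
      simp only [hT]
      ring)
    rw [← hS s hs _ rfl] at h1
    have h2 : S s - V s = (S s ^ 2 - V s ^ 2) * (S s + V s)⁻¹ := by
      field_simp
      ring
    rw [h2, show V s ^ 2 = truncS e₁ e₂ e₃ f (Complex.exp s) (Complex.exp s * s) ^ 2 from rfl, h1]
    ring

/-- The expansion of `Z = κ / (τ E)` that follows from the expansion of `E`. -/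
theorem isLittleO_inv_sub (hM : M ≤ 0) {E : ℂ → ℂ} (κ : ℂ) {e₁ e₂ e₃ f : ℂ}
    (hE1 : Tendsto E (logFilter M) (𝓝 1))
    (hE : (fun s => E s - truncE e₁ e₂ e₃ f (Complex.exp s) (Complex.exp s * s)) =o[logFilter M]
      fun s => Complex.exp s ^ 3) :
    (fun s => κ * (Complex.exp s * E s)⁻¹ - κ * (Complex.exp s)⁻¹ *
      (1 - e₁ * Complex.exp s + (e₁ ^ 2 - e₂) * Complex.exp s ^ 2 +
        (-e₁ ^ 3 + 2 * e₁ * e₂ - e₃ - f * s) * Complex.exp s ^ 3)) =o[logFilter M]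
      fun s => Complex.exp s ^ 2 := by
  obtain ⟨Ψ, hΨ, hΨ0, hid⟩ := inv_truncE_expansion e₁ e₂ e₃ f
  set P : ℂ → ℂ := fun s => 1 - e₁ * Complex.exp s + (e₁ ^ 2 - e₂) * Complex.exp s ^ 2 +
    (-e₁ ^ 3 + 2 * e₁ * e₂ - e₃ - f * s) * Complex.exp s ^ 3 with hP
  set T : ℂ → ℂ := fun s => truncE e₁ e₂ e₃ f (Complex.exp s) (Complex.exp s * s) with hT
  have hpair := (tendsto_exp_logFilter M).prodMk_nhds (tendsto_exp_mul_self_logFilter hM)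
  have hPO : P =O[logFilter M] fun _ => (1 : ℂ) := by
    have hc : Continuous fun p : ℂ × ℂ => 1 - e₁ * p.1 + (e₁ ^ 2 - e₂) * p.1 ^ 2 +
      ((-e₁ ^ 3 + 2 * e₁ * e₂ - e₃) * p.1 ^ 3 - f * p.2 * p.1 ^ 2) := by fun_prop
    refine (((hc.tendsto (0, 0)).comp hpair).isBigO_one ℂ).congr_left fun s => ?_
    simp only [Function.comp_apply, hP]
    ring
  have hnum : (fun s => Complex.exp s ^ 3 * Ψ (Complex.exp s, Complex.exp s * s) -
      P s * (E s - T s)) =o[logFilter M] fun s => Complex.exp s ^ 3 := by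
    refine IsLittleO.sub ?_ ?_
    · have h0 : Tendsto (fun s => Ψ (Complex.exp s, Complex.exp s * s)) (logFilter M) (𝓝 0) := by
        have := (hΨ.tendsto (0, 0)).comp hpair
        rwa [show ((0 : ℂ), (0 : ℂ)) = 0 from rfl, hΨ0] at this
      have := (isBigO_refl (fun s : ℂ => Complex.exp s ^ 3) (logFilter M)).mul_isLittleO
        ((isLittleO_one_iff ℂ).2 h0)
      simpa using this
    · simpa using hPO.mul_isLittleO hE
  have hfac : (fun s => κ * (E s)⁻¹ * (Complex.exp s)⁻¹) =O[logFilter M]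
      fun s => (Complex.exp s)⁻¹ := by
    have h1 := (((hE1.inv₀ one_ne_zero).const_mul κ).isBigO_one ℂ).mul
      (isBigO_refl (fun s : ℂ => (Complex.exp s)⁻¹) (logFilter M))
    simpa using h1
  have hmul := hnum.mul_isBigO hfac
  refine (hmul.congr' ?_ (Eventually.of_forall fun s => ?_))
  · filter_upwards [hE1.eventually_ne one_ne_zero] with s hs
    have h1 := hid (Complex.exp s) s
    have h2 : Complex.exp s ≠ 0 := Complex.exp_ne_zero s
    have h3 : Complex.exp s ^ 3 * Ψ (Complex.exp s, Complex.exp s * s) - P s * (E s - T s) =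
        1 - P s * E s := by
      rw [← h1]
      simp only [hP, hT]
      ring
    rw [h3]
    field_simp
    simp only [hP]
    ring
  · have h2 : Complex.exp s ≠ 0 := Complex.exp_ne_zero s
    field_simp

end Asymptotics

end ScalarODE

namespace QuadricConstants

open ScalarODE

theorem exists_logarithmic_branch (d : QuadricConstants 2) (hφ : d.φ = 0) (hε : d.ε ≠ 0) {κ : ℂ}
    (hκ : κ ^ 2 = -(d.ζ : ℂ)) (u₀ c : ℂ) : ∃ (M : ℝ) (W : ℂ → ℂ),
      (d.reducedODE 1).IsSolutionAlong (fun s => u₀ + Complex.exp s) (logRegion M) W ∧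
      (fun s : ℂ => W s -
        (κ * Complex.exp (-s)
          + ((d.X₀ 0 0 + d.X₀ 1 1 : ℝ) : ℂ) / 8
          - (32 * (u₀ * ((d.ε 0 ^ 2 + d.ε 1 ^ 2 : ℝ) : ℂ)
                + ((d.β 0 * d.ε 0 + d.β 1 * d.ε 1 : ℝ) : ℂ))
              - ((8 * d.X₀ 0 1 ^ 2 + 3 * (d.X₀ 0 0 ^ 2 + d.X₀ 1 1 ^ 2)
                  - 2 * d.X₀ 0 0 * d.X₀ 1 1 : ℝ) : ℂ)) / (192 * κ) * Complex.exp s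
          + (c + ((d.ε 0 ^ 2 + d.ε 1 ^ 2 : ℝ) : ℂ) / (8 * κ) * s) * Complex.exp s ^ 2))
        =o[comap Complex.re atBot ⊓ 𝓟 (logRegion M)]
          fun s : ℂ => Complex.exp s ^ 2 := by
  have hζ : (d.ζ : ℂ) ≠ 0 := by exact_mod_cast d.ζ_ne
  have hκ0 : κ ≠ 0 := by
    rintro rfl
    rw [zero_pow two_ne_zero, eq_comm, neg_eq_zero] at hκ
    exact hζ hκ
  have hε0 : (d.ε 0 : ℂ) ^ 2 + d.ε 1 ^ 2 ≠ 0 := by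
    have := d.normSqε_ne_zero hε
    rwa [normSqε, Fin.sum_univ_two] at this
  obtain ⟨e₁, he₁⟩ : ∃ e₁ : ℂ, e₁ = -(d.X₀ 0 0 + d.X₀ 1 1) / (8 * κ) := ⟨_, rfl⟩
  obtain ⟨e₂, he₂⟩ : ∃ e₂ : ℂ, e₂ = (((d.X₀ 0 0 : ℂ) * d.X₀ 1 1 - d.X₀ 0 1 ^ 2) / 4 +
      (d.β 0 * d.ε 0 + d.β 1 * d.ε 1) + u₀ * (d.ε 0 ^ 2 + d.ε 1 ^ 2)) / (6 * κ ^ 2) := ⟨_, rfl⟩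
  obtain ⟨f, hf⟩ : ∃ f : ℂ, f = -((d.ε 0 : ℂ) ^ 2 + d.ε 1 ^ 2) / (8 * κ ^ 2) := ⟨_, rfl⟩
  -- `e₃` is chosen to produce the prescribed coefficient of `(u - u₀) ^ 2`
  obtain ⟨e₃, he₃⟩ : ∃ e₃ : ℂ, e₃ = -c / κ - e₁ ^ 3 + 2 * e₁ * e₂ := ⟨_, rfl⟩
  obtain ⟨k, hk⟩ : ∃ k : ℂ, k = ((d.ε 0 : ℂ) ^ 2 * d.X₀ 1 1 + d.ε 1 ^ 2 * d.X₀ 0 0 -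
      2 * d.X₀ 0 1 * d.ε 0 * d.ε 1) / (2 * κ ^ 3) := ⟨_, rfl⟩
  obtain ⟨j, hj⟩ : ∃ j : ℂ, j = ((d.β 0 : ℂ) * d.ε 1 - d.β 1 * d.ε 0) ^ 2 / (4 * κ ^ 4) :=
    ⟨_, rfl⟩
  -- the constant term of `H`, determined by `e₃`
  obtain ⟨c₁, hc₁⟩ : ∃ c₁ : ℂ, c₁ = (2 * κ ^ 3 * (4 * e₁ * e₂ - 8 * e₃ - 10 * f) -
      (d.β 0 * d.ε 0 * d.X₀ 1 1 + d.β 1 * d.ε 1 * d.X₀ 0 0 -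
        d.X₀ 0 1 * (d.β 0 * d.ε 1 + d.β 1 * d.ε 0)) - u₀ * (2 * κ ^ 3 * k)) /
      (d.ε 0 ^ 2 + d.ε 1 ^ 2) := ⟨_, rfl⟩
  have hrad := d.radicand_two (e₁ := e₁) (e₂ := e₂) (e₃ := e₃) (f := f) (k := k) (j := j)
    (c := c₁) (u₀ := u₀) hκ0 (by rw [he₁]; field_simp) (by rw [he₂]; field_simp)
    (by rw [hf]; field_simp) (by rw [hk]; field_simp) (by rw [hj]; field_simp)
    (by rw [hc₁, div_mul_cancel₀ _ hε0]; ring)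
  have ha : κ ^ 2 = -16 * d.ζ / ((2 : ℕ) ^ 2 * (-2) ^ 2) := by
    rw [hκ]
    push_cast
    ring
  obtain ⟨C, M, hM, hex⟩ := d.exists_isBranchSystem le_rfl hε hκ0 u₀ c₁
  obtain ⟨E, S, H, hsys, hE, hS, hH, -⟩ := hex (logRegion M) (isOpen_logRegion M)
    (leftInvariant_logRegion M) (fun s hs => (re_lt_of_mem_logRegion hs).le)
    (fun _ s hs => norm_le_exp_of_mem_logRegion hM hs)
  -- the branch system is parametrized by `u = u₀ + e^{2s}`, the solution sought by `u = u₀ + e^s`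
  have hM2 : 2 * M ≤ 0 := by linarith
  have hhalf : ∀ s ∈ logRegion (2 * M), s / 2 ∈ logRegion M := by
    intro s hs
    simp only [logRegion, Set.mem_ofPred_eq, Complex.div_ofNat_re, Complex.div_ofNat_im, abs_div,
      abs_two] at hs ⊢
    linarith
  have hre : ∀ s : ℂ, (s / 2).re = s.re / 2 := fun s => by simp
  have htend : ∀ {φ : ℂ → ℂ} {b : ℂ}, (∀ s ∈ logRegion M, ‖φ s - b‖ ≤ C * Real.exp s.re) →
      Tendsto (fun s => φ (s / 2)) (logFilter (2 * M)) (𝓝 b) := fun hφ =>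
    tendsto_of_norm_sub_le_logFilter fun s hs => by
      rw [← hre]
      exact hφ _ (hhalf s hs)
  have hE1 := htend hE
  have hS1 := htend hS
  have hg0 := htend (φ := fun s => H s - logCoeff 2 κ * s - c₁) (b := 0) (by simpa using hH)
  have hexp : ∀ s : ℂ, Complex.exp ((2 : ℕ) * (s / 2)) = Complex.exp s := fun s => by
    congr 1
    push_cast
    ring
  refine ⟨2 * M, fun s => branchFun 2 κ (s / 2) (E (s / 2)), ?_, ?_⟩
  · refine (hsys.isSolutionAlong (isOpen_logRegion M) two_ne_zero hφ ha hκ0).reparam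
      (isOpen_logRegion M) fun s hs => ⟨fun s => s / 2, hhalf s hs, by fun_prop, ?_,
        Eventually.of_forall fun x => ?_, Eventually.of_forall fun x => rfl⟩
    · have h := (hasDerivAt_id s).div_const 2
      have h' : HasDerivAt (fun s : ℂ => s / 2) (1 / 2) s := h
      rw [h'.deriv]
      norm_num
    · simp only [hexp]
  · have hmain := isLittleO_sub_truncE (E := fun s => E (s / 2)) (S := fun s => S (s / 2))
      (g := fun s => H (s / 2) - logCoeff 2 κ * (s / 2) - c₁) (κ := κ) (e₁ := e₁) (e₂ := e₂)
      (e₃ := e₃) (f := f) (k := k) (j := j) (c := c₁) hM2 (fun s hs => ?_)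
      (fun s hs => hsys.norm_E_sub_one_le _ (hhalf s hs)) (fun s hs y hy => ?_) hE1 hS1 hg0
    · refine (isLittleO_inv_sub hM2 κ hE1 hmain).congr_left fun s => ?_
      have h0 := Complex.exp_ne_zero s
      simp only [branchFun_two]
      rw [Complex.exp_neg, he₃, hf, he₂, he₁]
      push_cast
      field_simp
      ring
    · have h1 := (hsys.hasDerivAt_E _ (hhalf s hs)).comp s
        (h := fun s => s / 2) ((hasDerivAt_id s).div_const 2)
      refine h1.congr_deriv ?_
      push_cast
      ring
    · have h1 := hsys.S_sq _ (hhalf s hs)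
      rw [hexp, branchFun_two, mul_inv, inv_inv, ← hy, inv_mul_eq_div] at h1
      rw [← hrad, h1]
      congr 1
      simp only [logCoeff, if_true]
      ring

end QuadricConstants

theorem mainTheorem2 :
    -- `(m, n) = (1, 1)`: equivalence with Painlevé I
    (∀ d : QuadricConstants 1, d.φ = 0 → d.ε ≠ 0 →
      (∃ a b l v : ℂ, (d.reducedODE 1).AffineEquiv ScalarODE.painleveI a b l v) ∧
      (d.β = 0 → d.X₀ = 0 →
        ∃ a l : ℂ, (d.reducedODE 1).AffineEquiv ScalarODE.painleveI a 0 l 0)) ∧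
    -- `m = 1`, `n > 1`: failure of the Painlevé property
    (∀ (n : ℕ) (d : QuadricConstants n), 1 < n → d.φ = 0 → d.ε ≠ 0 →
      ¬ (d.reducedODE 1).HasPainleveProperty) ∧
    -- `m = 1`, `n > 2`: movable algebraic branch points with exponent `-2 / n`, for a family of
    -- pairwise different (multi-valued) solutions at each `u₀`
    (∀ (n : ℕ) (d : QuadricConstants n), 2 < n → d.φ = 0 → d.ε ≠ 0 →
      ∀ u₀ : ℂ, ∃ W : ℂ → ℂ → ℂ,
        (∀ c : ℂ, (d.reducedODE 1).IsAlgebraicBranch u₀ (-2) n (W c)) ∧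
        ∀ c c' ω : ℂ, ω ^ n = 1 → (∀ᶠ t in 𝓝[≠] (0 : ℂ), W c (ω * t) = W c' t) → c = c') ∧
    -- `m = 1`, `n = 2`: movable logarithmic branch points, with `s = log (u - u₀)`
    (∀ d : QuadricConstants 2, d.φ = 0 → d.ε ≠ 0 →
      ∀ κ : ℂ, κ ^ 2 = -(d.ζ : ℂ) → ∀ u₀ c : ℂ, ∃ (M : ℝ) (W : ℂ → ℂ),
        (d.reducedODE 1).IsSolutionAlong (fun s => u₀ + Complex.exp s)
          (ScalarODE.logRegion M) W ∧
        (fun s : ℂ => W s -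
          (κ * Complex.exp (-s)
            + ((d.X₀ 0 0 + d.X₀ 1 1 : ℝ) : ℂ) / 8
            - (32 * (u₀ * ((d.ε 0 ^ 2 + d.ε 1 ^ 2 : ℝ) : ℂ)
                  + ((d.β 0 * d.ε 0 + d.β 1 * d.ε 1 : ℝ) : ℂ))
                - ((8 * d.X₀ 0 1 ^ 2 + 3 * (d.X₀ 0 0 ^ 2 + d.X₀ 1 1 ^ 2)
                    - 2 * d.X₀ 0 0 * d.X₀ 1 1 : ℝ) : ℂ)) / (192 * κ) * Complex.exp s
            + (c + ((d.ε 0 ^ 2 + d.ε 1 ^ 2 : ℝ) : ℂ) / (8 * κ) * s) * Complex.exp s ^ 2))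
          =o[comap Complex.re atBot ⊓ 𝓟 (ScalarODE.logRegion M)]
            fun s : ℂ => Complex.exp s ^ 2) :=
  ⟨fun d hφ hε => d.exists_affineEquiv_painleveI hφ hε,
    fun _ d hn hφ hε => d.not_hasPainleveProperty hn hφ hε,
    fun _ d hn hφ hε u₀ => d.exists_algebraic_branch_family hn hφ hε u₀,
    fun d hφ hε _ hκ u₀ c => d.exists_logarithmic_branch hφ hε hκ u₀ c⟩
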